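/- Let $\mathbb F$ be a field of characteristic $0$ and $N\ge 3$. Let $\mathcal W$ be the algebra of difference polynomials $\mathbb F[S^n(u_i)\mid 1\le i\le N-1,\ n\in\mathbb Z]$ with its automorphism $S$, localized by $u_1$ (i.e. all $S^n(u_1)$, $n\in\mathbb Z$, are inverted), and put $u_N=1$ and $u_k=0$ for $k>N$. Write $u_{i,n}=S^n(u_i)$. In formulas with $\lambda S$ the shift $S$ acts on everything to its right, and $\lambda$ commutes with everything. Equip $\mathcal W$ with the two (in general non-local) multiplicative $\lambda$-brackets $\mathcal W\otimes\mathcal W\to\mathcal W[[\lambda,\lambda^{-1}]]$ of the multiplicative $W$-algebra $\mathcal W_N$, which are given on generators ($1\le i,j\le N-1$) by $$\{u_i{}_\lambda u_j\}_1=\big((\lambda S)^{-i}-\lambda^j\big)u_{i+j},$$ $$\{u_i{}_\lambda u_j\}_2=\Big(\sum_{n=1}^{j}-\sum_{n=i}^{i+j-1}\Big)u_n(\lambda S)^{n-i}u_{i+j-n}+u_j\,\frac{\big((\lambda S)^N-(\lambda S)^j\big)\big(1-(\lambda S)^{-i}\big)}{(\lambda S)^N-1}\,u_i ,$$ where a rational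 function $r(\lambda S)$ stands for the half-sum of its expansions in non-negative and in non-positive direction (that is, $r(\lambda S)a=\sum_n r_n S^n(a)\lambda^n$, with $\sum_n r_nz^n=\frac12(r^+(z)+r^-(z))$, $r^\pm$ being the expansion of $r(z)$ in $\mathbb F((z^{\pm1}))$), and are extended to $\mathcal W$ by the Master Formula (equivalently, by sesquilinearity and the Leibniz rules) $$\{a_\lambda b\}=\sum_{i,j,m,n,k}\frac{\partial b}{\partial u_{j,n}}\,S^n\Big(h_{ji;k}\,S^{k-m}\Big(\frac{\partial a}{\partial u_{i,m}}\Big)\Big)\lambda^{n-m+k},\qquad \{u_i{}_\lambda u_j\}=\sum_k h_{ji;k}\lambda^k .$$ Let $\mathcal A_N\subset\mathcal W$ be the difference subalgebra (the $\mathbb F$-subalgebra stable under $S^{\pm1}$) generated by $$v_1=\frac1{u_1S(u_1)\cdots S^{N-1}(u_1)},\qquad v_i=\frac{u_i}{u_1S(u_1)\cdots S^{i-1}(u_1)}\quad(2\le i\le N-1).$$ Then both $\lambda$-brackets restrict to local $\lambda$-brackets on $\mathcal A_N$: for all $a,b\in\mathcal A_N$ and $s=1,2$, one has $\{a_\lambda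 b\}_s\in\mathcal A_N[\lambda,\lambda^{-1}]$. Explicitly, with the conventions $v_N=v_1$ and $v_i=0$ for $i>N$, and reading the quotients of the form $\frac{1-(\lambda S)^{\pm m}}{1-(\lambda S)^{\pm1}}$ as finite geometric sums: First bracket. (i) $\{v_1{}_\lambda v_1\}_1=v_1\frac{1-(\lambda S)^N}{1-\lambda S}\big((\lambda S)^{-1}v_2-v_2\lambda S\big)\frac{1-(\lambda S)^{-N}}{1-(\lambda S)^{-1}}v_1$; (ii) for $2\le j\le N-1$: $\{v_j{}_\lambda v_1\}_1=v_1\frac{1-(\lambda S)^N}{1-\lambda S}\big((\lambda S)^{-1}v_2-v_2\lambda S\big)\frac{1-(\lambda S)^{-j}}{1-(\lambda S)^{-1}}v_j+v_1\frac{1-(\lambda S)^N}{1-\lambda S}\big(\lambda-(\lambda S)^{-j}\big)v_{j+1}$; (iii) for $2\le i,j\le N-1$: $$\begin{aligned}\{v_j{}_\lambda v_i\}_1&=v_i\tfrac{1-(\lambda S)^i}{1-\lambda S}\big((\lambda S)^{-1}v_2-v_2\lambda S\big)\tfrac{1-(\lambda S)^{-j}}{1-(\lambda S)^{-1}}v_j+v_i\tfrac{1-(\lambda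 S)^i}{1-\lambda S}\big(\lambda-(\lambda S)^{-j}\big)v_{j+1}\\&\quad+\big(v_{i+1}(\lambda S)^i-(\lambda S)^{-1}v_{i+1}\big)\tfrac{1-(\lambda S)^{-j}}{1-(\lambda S)^{-1}}v_j+\big((\lambda S)^{-j}-\lambda^i\big)v_{i+j}.\end{aligned}$$ Second bracket. (i) $\{v_1{}_\lambda v_1\}_2=v_1\frac{(1-(\lambda S)^{1-N})(1-(\lambda S)^N)}{1-\lambda S}v_1$; (ii) for $2\le j\le N-1$: $\{v_j{}_\lambda v_1\}_2=v_1\frac{(1-(\lambda S)^{1-j})(1-(\lambda S)^N)}{1-\lambda S}v_j$; (iii) for $2\le i,j\le N-1$ with $i+j\le N+1$: $$\{v_j{}_\lambda v_i\}_2=v_i\tfrac{\lambda S(1-(\lambda S)^{i-1})(1-(\lambda S)^{-j})}{1-\lambda S}v_j-\Big(\sum_{p=2}^{j}-\sum_{p=i}^{i+j-2}\Big)v_{i+j-p}(\lambda S)^{i-p}v_p+\big((\lambda S)^{1-j}-\lambda^{i-1}\big)v_{i+j-1};$$ (iv) for $2\le i,j\le N-1$ with $i+j\ge N+2$: $$\{v_j{}_\lambda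 v_i\}_2=v_i\tfrac{\lambda S(1-(\lambda S)^{i-1})(1-(\lambda S)^{-j})}{1-\lambda S}v_j-\Big(\sum_{p=i+j-N}^{j}-\sum_{p=i}^{N}\Big)v_{i+j-p}(\lambda S)^{i-p}v_p.$$ For both brackets ($s=1,2$), the remaining brackets of generators are given by skew-symmetry: for $2\le j\le N-1$, $\{v_1{}_\lambda v_j\}_s=-\sum_n S^{-n}(c_n)\lambda^{-n}$, where $\{v_j{}_\lambda v_1\}_s=\sum_n c_n\lambda^n$. -/

import Mathlib

noncomputable section

namespace MultW

/-! ### Symbols of constant coefficient rational difference operators -/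

section Symbol

variable (F : Type*) [Field F]

theorem transcendental_single_one :
    Transcendental F (HahnSeries.single (1 : ℤ) (1 : F) : LaurentSeries F) := by
  rw [transcendental_iff]
  intro p hp
  have h : ∀ (q : Polynomial F) (n : ℕ),
      (Polynomial.aeval (HahnSeries.single (1 : ℤ) (1 : F) : LaurentSeries F) q).coeff n =
        q.coeff n := by
    intro q n
    induction q using Polynomial.induction_on' with
    | add p q hp hq => simp [hp, hq]
    | monomial k a =>
      rw [Polynomial.aeval_monomial, HahnSeries.single_pow, LaurentSeries.algebraMap_apply]
      simp [HahnSeries.C_apply, HahnSeries.coeff_single, Polynomial.coeff_monomial, eq_comm]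
  ext n
  rw [← h p n, hp]
  simp

theorem transcendental_single_one_inv :
    Transcendental F ((HahnSeries.single (1 : ℤ) (1 : F) : LaurentSeries F)⁻¹) := fun h =>
  transcendental_single_one F (IsAlgebraic.inv_iff.mp h)

variable {F}

/-- The embedding `F(S) → F((t))` sending `S` to a transcendental element `z` of `F((t))`. -/
def expand (z : LaurentSeries F) (hz : Transcendental F z) : RatFunc F →ₐ[F] LaurentSeries F :=
  RatFunc.liftAlgHom (Polynomial.aeval z)
    (nonZeroDivisors_le_comap_nonZeroDivisors_of_injective _
      (transcendental_iff_injective.mp hz))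

/-- Coefficient of `z ^ n` in the positive symbol, the expansion of `r(z)` in `F((z))`. -/
def posSymbol (r : RatFunc F) (n : ℤ) : F :=
  (expand _ (transcendental_single_one F) r).coeff n

/-- Coefficient of `z ^ n` in the negative symbol, the expansion of `r(z)` in `F((z⁻¹))`
(here the variable of the Laurent series is `t = z⁻¹`). -/
def negSymbol (r : RatFunc F) (n : ℤ) : F :=
  (expand _ (transcendental_single_one_inv F) r).coeff (-n)

/-- The symbol of a rational difference operator as a bilateral series: the half sum of its
positive and negative symbols. -/
def symbol (r : RatFunc F) (n : ℤ) : F :=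
  (posSymbol r n + negSymbol r n) / 2

end Symbol

/-! ### Difference polynomials, localized at the first variable -/

section Algebra

variable (F : Type*) [Field F] (N : ℕ)

/-- Indices of the variables `u_{i,n} = Sⁿ(u_i)`, `1 ≤ i ≤ N - 1`, `n ∈ ℤ`. -/
abbrev Var : Type := ↥(Finset.Ico 1 N) × ℤ

/-- The algebra of difference polynomials in `u_1, …, u_{N-1}`. -/
abbrev P := MvPolynomial (Var N) F

/-- `u_{k,n}`, with the conventions `u_N = 1` and `u_k = 0` for `k > N`. (Also `u_0 = 0`, but
`u_0` never occurs below.) -/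
def uP (k : ℕ) (n : ℤ) : P F N :=
  if h : k ∈ Finset.Ico 1 N then MvPolynomial.X (⟨k, h⟩, n) else if k = N then 1 else 0

/-- The automorphism `S` of the algebra of difference polynomials, `u_{i,n} ↦ u_{i,n+1}`. -/
def shiftP : P F N ≃ₐ[F] P F N :=
  MvPolynomial.renameEquiv F ((Equiv.refl _).prodCongr (Equiv.addRight (1 : ℤ)))

theorem shiftP_uP (k : ℕ) (n : ℤ) : shiftP F N (uP F N k n) = uP F N k (n + 1) := by
  unfold uP shiftP
  split_ifs <;> simp

/-- The multiplicative set generated by all `Sⁿ(u_1)`, `n ∈ ℤ`. -/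
def uOnes : Submonoid (P F N) :=
  Submonoid.closure (Set.range (uP F N 1))

theorem map_uOnes : (uOnes F N).map (shiftP F N : P F N →* P F N) = uOnes F N := by
  unfold uOnes
  rw [MonoidHom.map_mclosure, ← Set.range_comp]
  congr 1
  ext x
  constructor
  · rintro ⟨n, rfl⟩
    exact ⟨n + 1, (shiftP_uP F N 1 n).symm⟩
  · rintro ⟨n, rfl⟩
    refine ⟨n - 1, ?_⟩
    have h := shiftP_uP F N 1 (n - 1)
    rw [sub_add_cancel] at h
    exact h

/-- The difference algebra underlying `W_N`, localized by `u_1` (as a difference algebra: all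
`Sⁿ(u_1)`, `n ∈ ℤ`, are inverted). -/
abbrev W := Localization (uOnes F N)

/-- The automorphism `S` of the localized algebra. -/
def S : W F N ≃ₐ[F] W F N :=
  IsLocalization.algEquivOfAlgEquiv (M := uOnes F N) (T := uOnes F N) (W F N) (W F N)
    (shiftP F N) (map_uOnes F N)

/-- The generator `u_k`, with `u_N = 1` and `u_k = 0` for `k > N`. -/
def u (k : ℕ) : W F N := algebraMap (P F N) (W F N) (uP F N k 0)

/-- The inverse of `Sⁿ(u_1)`. -/
def uInv (n : ℤ) : W F N :=
  Localization.mk 1 ⟨uP F N 1 n, Submonoid.subset_closure ⟨n, rfl⟩⟩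

/-- `f ↦ f + ε ∂f/∂x`, from difference polynomials to the dual numbers of the localization. -/
def jetP (x : Var N) : P F N →ₐ[F] DualNumber (W F N) :=
  MvPolynomial.aeval fun y =>
    TrivSqZeroExt.inl (algebraMap (P F N) (W F N) (MvPolynomial.X y)) +
      if y = x then DualNumber.eps else 0

theorem fst_jetP (x : Var N) (f : P F N) :
    (jetP F N x f).fst = algebraMap (P F N) (W F N) f := by
  have h : (TrivSqZeroExt.fstHom F (W F N) (W F N)).comp (jetP F N x) =
      IsScalarTower.toAlgHom F (P F N) (W F N) := by
    ext y
    by_cases hy : y = x <;> simp [jetP, hy]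
  exact DFunLike.congr_fun h f

theorem isUnit_jetP (x : Var N) (y : uOnes F N) : IsUnit (jetP F N x y) := by
  rw [TrivSqZeroExt.isUnit_iff_isUnit_fst, fst_jetP]
  exact IsLocalization.map_units (W F N) y

/-- `f ↦ f + ε ∂f/∂x` on the localization. -/
def jet (x : Var N) : W F N →ₐ[F] DualNumber (W F N) :=
  IsLocalization.liftAlgHom (A := F) (M := uOnes F N) (S := W F N)
    (P := DualNumber (W F N)) (f := jetP F N x) (isUnit_jetP F N x)

theorem jet_algebraMap (x : Var N) (f : P F N) :
    jet F N x (algebraMap (P F N) (W F N) f) = jetP F N x f := by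
  simp [jet]

theorem fst_jet (x : Var N) (f : W F N) : (jet F N x f).fst = f := by
  have h : ((TrivSqZeroExt.fstHom F (W F N) (W F N)).comp (jet F N x) : W F N →+* W F N) =
      RingHom.id (W F N) := by
    refine IsLocalization.ringHom_ext (uOnes F N) (RingHom.ext fun f => ?_)
    simp [jet_algebraMap, fst_jetP]
  exact DFunLike.congr_fun h f

/-- The partial derivative `∂/∂u_{i,n}` of the localized algebra, where `x = (i, n)`. -/
def pd (x : Var N) : Derivation F (W F N) (W F N) :=
  Derivation.mk' ((TrivSqZeroExt.sndHom (W F N) (W F N)).restrictScalars F ∘ₗ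
      (jet F N x).toLinearMap) fun a b => by
    simp [fst_jet, mul_comm]

theorem pd_X (x : Var N) (y : Var N) :
    pd F N x (algebraMap (P F N) (W F N) (MvPolynomial.X y)) = if y = x then 1 else 0 := by
  by_cases hy : y = x <;> simp [pd, jet_algebraMap, jetP, hy]

theorem pd_algebraMap (x : Var N) (f : P F N) :
    pd F N x (algebraMap (P F N) (W F N) f) =
      algebraMap (P F N) (W F N) (MvPolynomial.pderiv x f) := by
  induction f using MvPolynomial.induction_on with
  | C a =>
    have h : algebraMap (P F N) (W F N) (MvPolynomial.C a) = algebraMap F (W F N) a :=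
      (IsScalarTower.algebraMap_apply F (P F N) (W F N) a).symm
    rw [h]
    simp
  | add p q hp hq => simp [hp, hq]
  | mul_X p y hp =>
    rw [map_mul, Derivation.leibniz, Derivation.leibniz, hp, pd_X, MvPolynomial.pderiv_X]
    by_cases hy : y = x
    · simp [hy]
    · simp [hy]

/-- Only finitely many partial derivatives of a given element are non-zero. -/
theorem finite_support_pd (f : W F N) : {x : Var N | pd F N x f ≠ 0}.Finite := by
  obtain ⟨⟨a, s⟩, h⟩ := IsLocalization.surj (uOnes F N) f
  refine (a.vars ∪ (s : P F N).vars).finite_toSet.subset fun x hx => ?_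
  by_contra hxs
  simp only [Finset.coe_union, Set.mem_union, Finset.mem_coe, not_or] at hxs
  have h1 := congrArg (pd F N x) h
  simp only at h1
  rw [Derivation.leibniz, pd_algebraMap, pd_algebraMap,
    MvPolynomial.pderiv_eq_zero_of_notMem_vars hxs.1,
    MvPolynomial.pderiv_eq_zero_of_notMem_vars hxs.2] at h1
  simp only [map_zero, mul_zero, zero_add, smul_eq_mul] at h1
  exact hx ((IsLocalization.map_units (W F N) s).mul_right_eq_zero.mp h1)

theorem S_algebraMap (f : P F N) :
    S F N (algebraMap (P F N) (W F N) f) = algebraMap (P F N) (W F N) (shiftP F N f) :=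
  IsLocalization.algEquivOfAlgEquiv_eq (map_uOnes F N) f

theorem S_zpow_uP (k : ℕ) (m n : ℤ) :
    (S F N ^ m) (algebraMap (P F N) (W F N) (uP F N k n)) =
      algebraMap (P F N) (W F N) (uP F N k (n + m)) := by
  induction m using Int.induction_on generalizing n with
  | zero => simp
  | succ m ih =>
    rw [zpow_add_one, AlgEquiv.mul_apply, S_algebraMap, shiftP_uP, ih]
    congr 2
    ring
  | pred m ih =>
    rw [zpow_sub_one, AlgEquiv.mul_apply]
    have h : (S F N)⁻¹ (algebraMap (P F N) (W F N) (uP F N k n)) =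
        algebraMap (P F N) (W F N) (uP F N k (n - 1)) := by
      have h1 := shiftP_uP F N k (n - 1)
      rw [sub_add_cancel] at h1
      rw [← h1, ← S_algebraMap]
      exact (S F N).symm_apply_apply _
    rw [h, ih]
    congr 2
    ring

theorem S_zpow_u_one_mul_uInv (n : ℤ) : (S F N ^ n) (u F N 1) * uInv F N n = 1 := by
  unfold u uInv
  rw [S_zpow_uP, zero_add, Localization.mk_eq_mk', IsLocalization.mul_mk'_eq_mk'_of_mul, mul_one]
  exact IsLocalization.mk'_self' (W F N)

/-! ### Bilateral series and `λ`-brackets -/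

variable {F N}

/-- An element `a` of the algebra, as a constant bilateral series. -/
def const (a : W F N) : ℤ → W F N := Pi.single 0 a

/-- Multiplication of a bilateral series `∑ fₙ λⁿ` by `λᵏ`. -/
def lam (k : ℤ) (f : ℤ → W F N) : ℤ → W F N := fun n => f (n - k)

/-- The action of `(λS)ᵏ` on bilateral series: `∑ fₙ λⁿ ↦ ∑ Sᵏ(fₙ) λⁿ⁺ᵏ`. Multiplication by an
element `a` of the algebra is the pointwise `a • f`. -/
def lamS (k : ℤ) (f : ℤ → W F N) : ℤ → W F N := fun n => (S F N ^ k) (f (n - k))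

/-- `r(λS) a = ∑ rₙ Sⁿ(a) λⁿ`, for a bilateral series `r(λ) = ∑ rₙ λⁿ` with constant
coefficients. -/
def act (r : ℤ → F) (a : W F N) : ℤ → W F N := fun n => r n • (S F N ^ n) a

/-- The non-local multiplicative `λ`-bracket on the localized algebra with
`{u_i λ u_j} = H i j`, given by the Master Formula
`{a λ b} = ∑ (∂b/∂u_{j,n}) Sⁿ(h_k S^{k-m} (∂a/∂u_{i,m})) λ^{n-m+k}`, the sum being over
`i, j, m, n, k`, where `H i j = ∑ h_k λᵏ`. Below is the coefficient of `λᵖ`, where `k` is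
`p - n + m`; the sum is finite by `finite_support_pd`. -/
def bracket (H : ℕ → ℕ → ℤ → W F N) (a b : W F N) (p : ℤ) : W F N :=
  ∑ᶠ (x : Var N) (y : Var N),
    pd F N y b * (S F N ^ y.2) (H x.1 y.1 (p - y.2 + x.2) *
      (S F N ^ (p - y.2)) (pd F N x a))

variable (F N)

/-- The first bracket on generators: `{u_i λ u_j}₁ = ((λS)⁻ⁱ - λʲ) u_{i+j}`. -/
def H1 (i j : ℕ) : ℤ → W F N :=
  lamS (-i) (const (u F N (i + j))) - lam j (const (u F N (i + j)))

/-- The rational function `(Sᴺ - Sʲ)(1 - S⁻ⁱ) / (Sᴺ - 1)`. -/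
def rat (i j : ℕ) : RatFunc F :=
  (RatFunc.X ^ N - RatFunc.X ^ j) * (1 - (RatFunc.X ^ i)⁻¹) / (RatFunc.X ^ N - 1)

/-- The second bracket on generators:
`{u_i λ u_j}₂ = (∑_{n=1}^j - ∑_{n=i}^{i+j-1}) u_n (λS)ⁿ⁻ⁱ u_{i+j-n}`
`  + u_j ((λS)ᴺ - (λS)ʲ) (1 - (λS)⁻ⁱ) / ((λS)ᴺ - 1) u_i`. -/
def H2 (i j : ℕ) : ℤ → W F N :=
  (∑ n ∈ Finset.Icc 1 j, u F N n • lamS ((n : ℤ) - i) (const (u F N (i + j - n)))) -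
    (∑ n ∈ Finset.Icc i (i + j - 1), u F N n • lamS ((n : ℤ) - i) (const (u F N (i + j - n)))) +
    u F N j • act (symbol (rat F N i j)) (u F N i)

/-- The first `λ`-bracket of the localized multiplicative `W`-algebra. -/
abbrev bracket1 : W F N → W F N → ℤ → W F N := bracket (H1 F N)

/-- The second `λ`-bracket of the localized multiplicative `W`-algebra. -/
abbrev bracket2 : W F N → W F N → ℤ → W F N := bracket (H2 F N)

/-! ### The Miura elements and the subalgebra generated by them -/

/-- `1 / (u_1 S(u_1) ⋯ S^{m-1}(u_1))`. -/
def invProd (m : ℕ) : W F N := ∏ k ∈ Finset.range m, uInv F N k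

/-- `v_1 = 1 / (u_1 ⋯ S^{N-1}(u_1))`, `v_i = u_i / (u_1 ⋯ S^{i-1}(u_1))` for `2 ≤ i ≤ N - 1`,
with the conventions `v_N = v_1` and `v_i = 0` for `i > N`. (Also `v_0 = 0`, but `v_0` never
occurs below.) -/
def v (i : ℕ) : W F N :=
  if i = 1 ∨ i = N then invProd F N N
  else if 2 ≤ i ∧ i < N then u F N i * invProd F N i
  else 0

/-- The difference subalgebra `A_N` generated by `v_1, …, v_{N-1}`. -/
def A : Subalgebra F (W F N) :=
  Algebra.adjoin F {a | ∃ i ∈ Finset.Ico 1 N, ∃ n : ℤ, a = (S F N ^ n) (v F N i)}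

variable {F N}

/-- The `λ`-bracket `B` restricts to a local `λ`-bracket `B₀ ⊗ B₀ → B₀[λ, λ⁻¹]` on the subalgebra
`B₀`: all brackets of elements of `B₀` are Laurent polynomials with coefficients in `B₀`. -/
def IsLocalOn (B : W F N → W F N → ℤ → W F N) (B₀ : Subalgebra F (W F N)) : Prop :=
  ∀ a ∈ B₀, ∀ b ∈ B₀, (∀ n, B a b n ∈ B₀) ∧ {n | B a b n ≠ 0}.Finite

/-- `(1 - (λS)ᵐ) / (1 - λS) = 1 + λS + ⋯ + (λS)^{m-1}`. -/
def geom (m : ℕ) (f : ℤ → W F N) : ℤ → W F N := ∑ k ∈ Finset.range m, lamS k f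

/-- `(1 - (λS)⁻ᵐ) / (1 - (λS)⁻¹) = 1 + (λS)⁻¹ + ⋯ + (λS)^{1-m}`. -/
def geomInv (m : ℕ) (f : ℤ → W F N) : ℤ → W F N := ∑ k ∈ Finset.range m, lamS (-k) f

/-- `((λS)⁻¹ v_2 - v_2 λS) f`. -/
def mid (f : ℤ → W F N) : ℤ → W F N := lamS (-1) (v F N 2 • f) - v F N 2 • lamS 1 f

/-- The series `-{b_{λ⁻¹S⁻¹} a}`, for a series `f = {b_λ a}`. -/
def skew (f : ℤ → W F N) : ℤ → W F N := fun n => -(S F N ^ n) (f (-n))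

end Algebra

end MultW

end

open MultW

/-! The Master Formula gives sesquilinearity and the two Leibniz rules, so everything reduces to
brackets of generators. Put m_i = u_i / (u_1 ⋯ S^{i-1}(u_1)) (`miura`): then m_1 = 1, m_i = v_i for
i ≥ 2, and m_N = v_N = v_1. Hence v_2, …, v_N generate A_N and all brackets come from one
computation with indices up to N. The formulas H(i,j) for {u_i λ u_j} remain valid at index N, where
u_N = 1 is central, because both H vanish there (`H1_boundary`, `H2_boundary`).

Let p_i = `invProd F N i` and B(j,i) = p_i {m_j λ u_i}. The Leibniz rule in the right argument gives
{m_j λ m_i} = B(j,i) - m_i (1 + λS + ⋯ + (λS)^{i-1}) B(j,1), so only B matters. For the first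
bracket, the factors u_1⁻¹ regroup so that B involves only the m's (`invProd_smul_bracket1`). For
the second, the rational symbol for (j,i) is (1 + z⁻¹ + ⋯ + z^{1-j}) times the one for (1,i)
(`rat_eq_sum`). This geometric sum is exactly what differentiating p_j produces, so the non-local
terms cancel and B is the quadratic part of H with u replaced by m (`invProd_smul_bracket2`).

Both brackets of generators are therefore Laurent polynomials over A_N, and the Leibniz rules
propagate this to A_N. The stated formulas follow by separating the terms containing m_1 = 1 and
discarding those with index above N. Of the half-sum expansion the argument uses only additivity,
compatibility with powers of z, and that 1 expands to 1. -/

noncomputable section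

namespace MultW

/-! ### Leibniz rules, sesquilinearity and skew-symmetry from the Master Formula -/

section Bracket

variable {F : Type*} [Field F] {N : ℕ}

theorem S_zpow_S (k : ℤ) (a : W F N) : (S F N ^ k) (S F N a) = (S F N ^ (k + 1)) a := by
  rw [zpow_add_one, AlgEquiv.mul_apply]

theorem S_S_zpow (k : ℤ) (a : W F N) : S F N ((S F N ^ k) a) = (S F N ^ (k + 1)) a := by
  rw [add_comm, zpow_one_add, AlgEquiv.mul_apply]

theorem S_zpow_S_zpow (k l : ℤ) (a : W F N) :
    (S F N ^ k) ((S F N ^ l) a) = (S F N ^ (k + l)) a := by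
  rw [zpow_add, AlgEquiv.mul_apply]

theorem S_zpow_zero (a : W F N) : (S F N ^ (0 : ℤ)) a = a := by simp

theorem shiftP_X (y : Var N) :
    shiftP F N (MvPolynomial.X y) = MvPolynomial.X (y.1, y.2 + 1) := by
  simp [shiftP]; rfl

theorem pd_S_algebraMap (x : Var N) (f : P F N) :
    pd F N x (S F N (algebraMap _ _ f)) = S F N (pd F N (x.1, x.2 - 1) (algebraMap _ _ f)) := by
  induction f using MvPolynomial.induction_on with
  | C a =>
    have h : algebraMap (P F N) (W F N) (MvPolynomial.C a) = algebraMap F (W F N) a :=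
      (IsScalarTower.algebraMap_apply F (P F N) (W F N) a).symm
    rw [h]
    simp
  | add p q hp hq => simp [hp, hq]
  | mul_X p y hp =>
    rw [map_mul, map_mul, Derivation.leibniz, Derivation.leibniz, hp, pd_X, S_algebraMap,
      S_algebraMap, shiftP_X, pd_X]
    have : (((y.1, y.2 + 1) : Var N) = x) ↔ y = (x.1, x.2 - 1) := by
      rw [Prod.ext_iff, Prod.ext_iff]
      simp only [eq_sub_iff_add_eq]
    simp [this, S_algebraMap, shiftP_X, apply_ite]

/-- Partial derivatives commute with the shift: `∂/∂u_{i,n} ∘ S = S ∘ ∂/∂u_{i,n-1}`. -/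
theorem pd_S (x : Var N) (a : W F N) :
    pd F N x (S F N a) = S F N (pd F N (x.1, x.2 - 1) a) := by
  obtain ⟨⟨p, s⟩, h⟩ := IsLocalization.surj (uOnes F N) a
  simp only at h
  -- Both sides of the claim obey the same S-twisted Leibniz rule and agree on polynomials. Compare
  -- them on `a * s = p` and cancel the unit `S s`.
  have h1 := congrArg (fun b => pd F N x (S F N b)) h
  have h2 := congrArg (fun b => S F N (pd F N (x.1, x.2 - 1) b)) h
  simp only [pd_S_algebraMap] at h1
  rw [← h2, map_mul, Derivation.leibniz, Derivation.leibniz, map_add, pd_S_algebraMap] at h1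
  simp only [smul_eq_mul, map_mul, add_right_inj] at h1
  exact ((IsLocalization.map_units (W F N) s).map (S F N)).mul_left_cancel h1

variable (H : ℕ → ℕ → ℤ → W F N)

/-- Any finite sets containing the supports may be used, so that several brackets can be compared
term by term over common index sets. -/
theorem bracket_eq_sum {a b : W F N} {s t : Finset (Var N)}
    (hs : ∀ x, x ∉ s → pd F N x a = 0) (ht : ∀ y, y ∉ t → pd F N y b = 0) (p : ℤ) :
    bracket H a b p = ∑ x ∈ s, ∑ y ∈ t, pd F N y b * (S F N ^ y.2) (H x.1 y.1 (p - y.2 + x.2) *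
      (S F N ^ (p - y.2)) (pd F N x a)) := by
  unfold bracket
  rw [finsum_eq_sum_of_support_subset (s := s)]
  · refine Finset.sum_congr rfl fun x _ => ?_
    rw [finsum_eq_sum_of_support_subset (s := t)]
    intro y hy
    by_contra hyt
    exact hy (by simp [ht y hyt])
  · intro x hx
    by_contra hxs
    exact hx (by simp [hs x hxs])

/-- A finite set of variables containing those on which an element depends. -/
theorem exists_vars (a : W F N) : ∃ s : Finset (Var N), ∀ x, x ∉ s → pd F N x a = 0 :=
  ⟨(finite_support_pd F N a).toFinset, fun x hx => by simpa using hx⟩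

theorem exists_vars₂ (a b : W F N) :
    ∃ s : Finset (Var N), ∀ x, x ∉ s → pd F N x a = 0 ∧ pd F N x b = 0 := by
  obtain ⟨s, hs⟩ := exists_vars a
  obtain ⟨t, ht⟩ := exists_vars b
  refine ⟨s ∪ t, fun x hx => ?_⟩
  rw [Finset.mem_union, not_or] at hx
  exact ⟨hs x hx.1, ht x hx.2⟩

theorem bracket_add_right (a b c : W F N) :
    bracket H a (b + c) = bracket H a b + bracket H a c := by
  obtain ⟨s, hs⟩ := exists_vars a
  obtain ⟨t, ht⟩ := exists_vars₂ b c
  funext p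
  rw [Pi.add_apply, bracket_eq_sum H hs (fun y hy => (ht y hy).1),
    bracket_eq_sum H hs (fun y hy => (ht y hy).2),
    bracket_eq_sum H hs (fun y hy => by simp [ht y hy]), ← Finset.sum_add_distrib]
  refine Finset.sum_congr rfl fun x _ => ?_
  rw [← Finset.sum_add_distrib]
  refine Finset.sum_congr rfl fun y _ => ?_
  rw [map_add, add_mul]

theorem bracket_add_left (a b c : W F N) :
    bracket H (a + b) c = bracket H a c + bracket H b c := by
  obtain ⟨s, hs⟩ := exists_vars₂ a b
  obtain ⟨t, ht⟩ := exists_vars c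
  funext p
  rw [Pi.add_apply, bracket_eq_sum H (fun x hx => (hs x hx).1) ht,
    bracket_eq_sum H (fun x hx => (hs x hx).2) ht,
    bracket_eq_sum H (fun x hx => by simp [hs x hx]) ht, ← Finset.sum_add_distrib]
  refine Finset.sum_congr rfl fun x _ => ?_
  rw [← Finset.sum_add_distrib]
  refine Finset.sum_congr rfl fun y _ => ?_
  rw [map_add, map_add, mul_add, map_add, mul_add]

theorem bracket_algebraMap_right (a : W F N) (r : F) : bracket H a (algebraMap F _ r) = 0 := by
  funext p
  simp [bracket]

theorem bracket_algebraMap_left (a : W F N) (r : F) : bracket H (algebraMap F _ r) a = 0 := by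
  funext p
  simp [bracket]

theorem bracket_one_right (a : W F N) : bracket H a 1 = 0 := by
  funext p
  simp [bracket]

theorem bracket_one_left (a : W F N) : bracket H 1 a = 0 := by
  funext p
  simp [bracket]

/-- The composition `f(λS) ∘ c` of a bilateral series with the multiplication by `c`. -/
def rmul (c : W F N) (f : ℤ → W F N) : ℤ → W F N := fun n => f n * (S F N ^ n) c

theorem bracket_mul_right (a b c : W F N) :
    bracket H a (b * c) = b • bracket H a c + c • bracket H a b := by
  obtain ⟨s, hs⟩ := exists_vars a
  obtain ⟨t, ht⟩ := exists_vars₂ b c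
  funext p
  rw [Pi.add_apply, Pi.smul_apply, Pi.smul_apply, bracket_eq_sum H hs (fun y hy => (ht y hy).1),
    bracket_eq_sum H hs (fun y hy => (ht y hy).2),
    bracket_eq_sum H hs (fun y hy => by simp [ht y hy]), Finset.smul_sum, Finset.smul_sum,
    ← Finset.sum_add_distrib]
  refine Finset.sum_congr rfl fun x _ => ?_
  rw [Finset.smul_sum, Finset.smul_sum, ← Finset.sum_add_distrib]
  refine Finset.sum_congr rfl fun y _ => ?_
  rw [Derivation.leibniz]
  simp only [smul_eq_mul]
  ring

/-- In the coefficient of λ^p the undifferentiated factor is hit by S^n S^{p-n} = S^p, whatever the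
variables, so it leaves the sum as a right multiplication. -/
theorem bracket_mul_left (a b c : W F N) :
    bracket H (a * b) c = rmul a (bracket H b c) + rmul b (bracket H a c) := by
  obtain ⟨s, hs⟩ := exists_vars₂ a b
  obtain ⟨t, ht⟩ := exists_vars c
  funext p
  rw [Pi.add_apply, rmul, rmul, bracket_eq_sum H (fun x hx => (hs x hx).1) ht,
    bracket_eq_sum H (fun x hx => (hs x hx).2) ht,
    bracket_eq_sum H (fun x hx => by simp [hs x hx]) ht, Finset.sum_mul, Finset.sum_mul,
    ← Finset.sum_add_distrib]
  refine Finset.sum_congr rfl fun x _ => ?_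
  rw [Finset.sum_mul, Finset.sum_mul, ← Finset.sum_add_distrib]
  refine Finset.sum_congr rfl fun y _ => ?_
  rw [Derivation.leibniz]
  simp only [smul_eq_mul, map_mul, map_add, S_zpow_S_zpow, add_sub_cancel]
  ring

/-- The shift of the variables by `k`. -/
def shiftVar (N : ℕ) (k : ℤ) : Var N ≃ Var N := (Equiv.refl _).prodCongr (Equiv.addRight k)

theorem bracket_S_right (a b : W F N) : bracket H a (S F N b) = lamS 1 (bracket H a b) := by
  obtain ⟨s, hs⟩ := exists_vars a
  obtain ⟨t, ht⟩ := exists_vars b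
  funext p
  rw [lamS, bracket_eq_sum H hs ht,
    bracket_eq_sum H (t := t.map (shiftVar N 1).toEmbedding) hs fun y hy => ?_, map_sum]
  · refine Finset.sum_congr rfl fun x _ => ?_
    rw [map_sum, Finset.sum_map]
    refine Finset.sum_congr rfl fun y _ => ?_
    have h1 : ((shiftVar N 1).toEmbedding y) = (y.1, y.2 + 1) := rfl
    rw [h1, pd_S]
    simp only [map_mul, S_zpow_S_zpow, zpow_one, S_S_zpow, add_sub_cancel_right]
    congr 3 <;> ring_nf
  · rw [pd_S, ht, map_zero]
    contrapose! hy
    rw [Finset.mem_map]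
    exact ⟨_, hy, by simp [shiftVar]⟩

theorem bracket_S_left (a b : W F N) : bracket H (S F N a) b = lam (-1) (bracket H a b) := by
  obtain ⟨s, hs⟩ := exists_vars a
  obtain ⟨t, ht⟩ := exists_vars b
  funext p
  rw [lam, bracket_eq_sum H hs ht,
    bracket_eq_sum H (s := s.map (shiftVar N 1).toEmbedding) (fun y hy => ?_) ht]
  · rw [Finset.sum_map]
    refine Finset.sum_congr rfl fun x _ => ?_
    refine Finset.sum_congr rfl fun y _ => ?_
    have h1 : ((shiftVar N 1).toEmbedding x) = (x.1, x.2 + 1) := rfl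
    rw [h1, pd_S]
    simp only [S_zpow_S, add_sub_cancel_right]
    congr 3
    · ring_nf
    · ring_nf
  · rw [pd_S, hs, map_zero]
    contrapose! hy
    rw [Finset.mem_map]
    exact ⟨_, hy, by simp [shiftVar]⟩

theorem lamS_lamS (k l : ℤ) (f : ℤ → W F N) : lamS k (lamS l f) = lamS (k + l) f := by
  funext n
  simp only [lamS, S_zpow_S_zpow]
  ring_nf

theorem lam_lam (k l : ℤ) (f : ℤ → W F N) : lam k (lam l f) = lam (k + l) f := by
  funext n
  simp only [lam]
  ring_nf

theorem lamS_zero (f : ℤ → W F N) : lamS 0 f = f := by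
  funext n
  simp [lamS]

theorem lam_zero (f : ℤ → W F N) : lam 0 f = f := by
  funext n
  simp [lam]

theorem bracket_S_zpow_right (k : ℤ) (a b : W F N) :
    bracket H a ((S F N ^ k) b) = lamS k (bracket H a b) := by
  induction k using Int.induction_on with
  | zero => simp [lamS_zero]
  | succ k ih =>
    rw [← S_S_zpow, bracket_S_right, ih, lamS_lamS, add_comm]
  | pred k ih =>
    -- For negative powers, use the rule for `S` one step below and invert `lamS 1`.
    have h := bracket_S_right H a ((S F N ^ (-(k : ℤ) - 1)) b)
    rw [S_S_zpow, sub_add_cancel, ih] at h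
    have h1 := congrArg (lamS (-1)) h
    rw [lamS_lamS, lamS_lamS, neg_add_cancel, lamS_zero] at h1
    rw [← h1]
    ring_nf

theorem bracket_S_zpow_left (k : ℤ) (a b : W F N) :
    bracket H ((S F N ^ k) a) b = lam (-k) (bracket H a b) := by
  induction k using Int.induction_on with
  | zero => simp [lam_zero]
  | succ k ih =>
    rw [← S_S_zpow, bracket_S_left, ih, lam_lam]
    ring_nf
  | pred k ih =>
    have h := bracket_S_left H ((S F N ^ (-(k : ℤ) - 1)) a) b
    rw [S_S_zpow, sub_add_cancel, ih] at h
    have h1 := congrArg (lam 1) h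
    rw [lam_lam, lam_lam, add_neg_cancel, lam_zero] at h1
    rw [← h1]
    ring_nf

theorem uP_of_mem {i : ℕ} (hi : i ∈ Finset.Ico 1 N) (n : ℤ) :
    uP F N i n = MvPolynomial.X (⟨i, hi⟩, n) := by
  rw [uP, dif_pos hi]

theorem bracket_u_u {i j : ℕ} (hi : i ∈ Finset.Ico 1 N) (hj : j ∈ Finset.Ico 1 N) :
    bracket H (u F N i) (u F N j) = H i j := by
  funext p
  rw [u, u, uP_of_mem hi, uP_of_mem hj, bracket_eq_sum H (s := {(⟨i, hi⟩, 0)})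
    (t := {(⟨j, hj⟩, 0)})]
  · simp [pd_X]
  · intro x hx
    rw [pd_X, if_neg]
    rintro rfl
    simp at hx
  · intro x hx
    rw [pd_X, if_neg]
    rintro rfl
    simp at hx

/-- The double sums match term by term once the roles of the two variables are exchanged. -/
theorem bracket_skew
    (hH : ∀ i ∈ Finset.Ico 1 N, ∀ j ∈ Finset.Ico 1 N, H i j = skew (H j i)) (a b : W F N) :
    bracket H a b = skew (bracket H b a) := by
  obtain ⟨s, hs⟩ := exists_vars a
  obtain ⟨t, ht⟩ := exists_vars b
  funext p
  rw [skew, bracket_eq_sum H hs ht, bracket_eq_sum H ht hs, Finset.sum_comm, map_sum,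
    ← Finset.sum_neg_distrib]
  refine Finset.sum_congr rfl fun y _ => ?_
  rw [map_sum, ← Finset.sum_neg_distrib]
  refine Finset.sum_congr rfl fun x _ => ?_
  rw [hH _ x.1.2 _ y.1.2, skew]
  simp only [map_mul, map_neg, S_zpow_S_zpow]
  rw [show y.2 + (p - y.2) = p by ring, show y.2 + (p - y.2 + x.2) = p + x.2 by ring,
    show p + (x.2 + (-p - x.2)) = 0 by ring, show -(p - y.2 + x.2) = -p - x.2 + y.2 by ring,
    S_zpow_zero]
  ring

end Bracket

/-! ### The elements m_i, bilateral series, and brackets with quotients -/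

section Generators

variable {F : Type*} [Field F] {N : ℕ}

theorem u_one_mul_uInv : u F N 1 * uInv F N 0 = 1 := by
  simpa using S_zpow_u_one_mul_uInv F N 0

theorem uInv_mul_u_one : uInv F N 0 * u F N 1 = 1 := by
  rw [mul_comm, u_one_mul_uInv]

theorem S_zpow_uInv (k : ℤ) : (S F N ^ k) (uInv F N 0) = uInv F N k := by
  have h1 := S_zpow_u_one_mul_uInv F N k
  have h2 := congrArg (S F N ^ k) (u_one_mul_uInv (F := F) (N := N))
  rw [map_mul, map_one] at h2
  calc (S F N ^ k) (uInv F N 0)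
      = (S F N ^ k) (uInv F N 0) * ((S F N ^ k) (u F N 1) * uInv F N k) := by rw [h1, mul_one]
    _ = ((S F N ^ k) (u F N 1) * (S F N ^ k) (uInv F N 0)) * uInv F N k := by ring
    _ = uInv F N k := by rw [h2, one_mul]

theorem invProd_zero : invProd F N 0 = 1 := by simp [invProd]

theorem invProd_succ (m : ℕ) :
    invProd F N (m + 1) = invProd F N m * (S F N ^ (m : ℤ)) (uInv F N 0) := by
  rw [invProd, Finset.prod_range_succ, S_zpow_uInv, invProd]

theorem invProd_one : invProd F N 1 = uInv F N 0 := by simp [invProd]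

theorem invProd_add (m k : ℕ) :
    invProd F N (m + k) = invProd F N m * (S F N ^ (m : ℤ)) (invProd F N k) := by
  induction k with
  | zero => simp [invProd_zero]
  | succ k ih =>
    rw [← add_assoc, invProd_succ, ih, invProd_succ, map_mul, S_zpow_S_zpow]
    push_cast
    ring

theorem u_self : u F N N = 1 := by
  simp [u, uP]

theorem u_eq_zero {k : ℕ} (hk : N < k) : u F N k = 0 := by
  rw [u, uP, dif_neg, if_neg, map_zero]
  · omega
  · simp; omega

/-- `u_m / (u_1 S(u_1) ⋯ S^{m-1}(u_1))`. -/
def miura (F : Type*) [Field F] (N m : ℕ) : W F N := u F N m * invProd F N m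

theorem miura_one : miura F N 1 = 1 := by
  rw [miura, invProd_one, u_one_mul_uInv]

/-- The conventions u_N = 1 and u_k = 0 for k > N absorb the case distinction in `v`. Index 1 is
excluded: there `miura` is 1, whereas v_1 = v_N. -/
theorem miura_eq_v {m : ℕ} (hm : 2 ≤ m) : miura F N m = v F N m := by
  rw [miura, v]
  rcases lt_trichotomy m N with h | h | h
  · rw [if_neg (by omega), if_pos ⟨hm, h⟩]
  · rw [h, u_self, one_mul, if_pos (Or.inr rfl)]
  · rw [if_neg (by omega), if_neg (by omega), u_eq_zero h, zero_mul]

theorem v_one : v F N 1 = v F N N := by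
  simp [v]

theorem v_eq_zero {m : ℕ} (hm : 2 ≤ m) (h : N < m) : v F N m = 0 := by
  rw [← miura_eq_v hm, miura, u_eq_zero h, zero_mul]

/-! ### Calculus of bilateral series -/

theorem rmul_add (c : W F N) (f g : ℤ → W F N) : rmul c (f + g) = rmul c f + rmul c g := by
  funext n; simp [rmul, add_mul]

theorem rmul_neg (c : W F N) (f : ℤ → W F N) : rmul c (-f) = -rmul c f := by
  funext n; simp only [rmul, Pi.neg_apply]; ring

theorem rmul_sub (c : W F N) (f g : ℤ → W F N) : rmul c (f - g) = rmul c f - rmul c g := by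
  funext n; simp [rmul, sub_mul]

theorem rmul_zero (c : W F N) : rmul c 0 = 0 := by
  funext n; simp [rmul]

theorem rmul_smul (c a : W F N) (f : ℤ → W F N) : rmul c (a • f) = a • rmul c f := by
  funext n; simp [rmul, mul_assoc]

theorem rmul_sum {ι : Type*} (s : Finset ι) (c : W F N) (f : ι → ℤ → W F N) :
    rmul c (∑ k ∈ s, f k) = ∑ k ∈ s, rmul c (f k) := by
  funext n; simp [rmul, Finset.sum_apply, Finset.sum_mul]

theorem rmul_rmul (a b : W F N) (f : ℤ → W F N) : rmul a (rmul b f) = rmul (b * a) f := by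
  funext n; simp [rmul, mul_assoc]

theorem rmul_single (c a : W F N) (m : ℤ) :
    rmul c (Pi.single m a) = Pi.single m (a * (S F N ^ m) c) := by
  funext n
  by_cases h : n = m
  · subst h; simp [rmul]
  · simp [rmul, h]

theorem lamS_add (k : ℤ) (f g : ℤ → W F N) : lamS k (f + g) = lamS k f + lamS k g := by
  funext n; simp [lamS]

theorem lamS_sub (k : ℤ) (f g : ℤ → W F N) : lamS k (f - g) = lamS k f - lamS k g := by
  funext n; simp [lamS]

theorem lamS_neg (k : ℤ) (f : ℤ → W F N) : lamS k (-f) = -lamS k f := by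
  funext n; simp [lamS]

theorem lamS_sum {ι : Type*} (s : Finset ι) (k : ℤ) (f : ι → ℤ → W F N) :
    lamS k (∑ i ∈ s, f i) = ∑ i ∈ s, lamS k (f i) := by
  funext n; simp [lamS, Finset.sum_apply]

theorem lamS_smul (k : ℤ) (a : W F N) (f : ℤ → W F N) :
    lamS k (a • f) = (S F N ^ k) a • lamS k f := by
  funext n; simp [lamS]

theorem lamS_single (k m : ℤ) (a : W F N) :
    lamS k (Pi.single m a) = Pi.single (m + k) ((S F N ^ k) a) := by
  funext n
  by_cases h : n = m + k
  · subst h; simp [lamS]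
  · rw [lamS, Pi.single_eq_of_ne (by omega), Pi.single_eq_of_ne h, map_zero]

theorem lam_single (k m : ℤ) (a : W F N) :
    lam k (Pi.single m a) = Pi.single (m + k) a := by
  funext n
  by_cases h : n = m + k
  · subst h; simp [lam]
  · rw [lam, Pi.single_eq_of_ne (by omega), Pi.single_eq_of_ne h]

theorem lam_zero_right (k : ℤ) : lam k (0 : ℤ → W F N) = 0 := rfl

theorem lamS_zero_right (k : ℤ) : lamS k (0 : ℤ → W F N) = 0 := by
  funext n; simp [lamS]

theorem const_zero : const (0 : W F N) = 0 := Pi.single_zero _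

theorem smul_single (m : ℤ) (a b : W F N) :
    a • (Pi.single m b : ℤ → W F N) = Pi.single m (a * b) := by
  rw [← Pi.single_smul, smul_eq_mul]

theorem geom_sub (m : ℕ) (f g : ℤ → W F N) : geom m (f - g) = geom m f - geom m g := by
  simp [geom, lamS_sub, Finset.sum_sub_distrib]

theorem geom_succ (m : ℕ) (f : ℤ → W F N) : geom (m + 1) f = geom m f + lamS m f :=
  Finset.sum_range_succ _ _

/-- Letting the operator act on `c` turns each monomial λ^{m-k} into (λS)^{m-k}. This is how the sum
produced by a product of inverses in the left argument becomes `geomInv`. -/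
theorem rmul_sum_lam_single (c a : W F N) (m : ℤ) (j : ℕ) :
    rmul c (∑ k ∈ Finset.range j, lam (-(k : ℤ)) (Pi.single m a)) =
      a • lamS m (geomInv j (const c)) := by
  rw [rmul_sum, geomInv, lamS_sum, Finset.smul_sum]
  refine Finset.sum_congr rfl fun k _ => ?_
  rw [lam_single, rmul_single, const, lamS_lamS, lamS_single, smul_single, zero_add]

/-! ### Brackets of quotients -/

variable (H : ℕ → ℕ → ℤ → W F N)

theorem bracket_uInv_left (b : W F N) :
    bracket H (uInv F N 0) b = -rmul (uInv F N 0 * uInv F N 0) (bracket H (u F N 1) b) := by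
  have h := bracket_mul_left H (u F N 1) (uInv F N 0) b
  rw [u_one_mul_uInv, bracket_one_left] at h
  have h1 := congrArg (rmul (uInv F N 0)) h
  rw [rmul_zero, rmul_add, rmul_rmul, rmul_rmul, u_one_mul_uInv] at h1
  have h2 : rmul 1 (bracket H (uInv F N 0) b) = bracket H (uInv F N 0) b := by
    funext n; simp [rmul]
  rw [h2] at h1
  exact eq_neg_of_add_eq_zero_left h1.symm

theorem bracket_uInv_right (a : W F N) :
    bracket H a (uInv F N 0) = -((uInv F N 0 * uInv F N 0) • bracket H a (u F N 1)) := by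
  have h := bracket_mul_right H a (u F N 1) (uInv F N 0)
  rw [u_one_mul_uInv, bracket_one_right] at h
  have h1 := congrArg (fun f => uInv F N 0 • f) h
  simp only [smul_zero, smul_add, smul_smul, uInv_mul_u_one, one_smul] at h1
  exact eq_neg_of_add_eq_zero_left h1.symm

/-- Logarithmic derivative of a product: each factor S^k(u_1)⁻¹ contributes one term, and
sesquilinearity supplies its λ^{-k}. -/
theorem bracket_invProd_left (m : ℕ) (b : W F N) :
    bracket H (invProd F N m) b = -rmul (invProd F N m)
      (∑ k ∈ Finset.range m, lam (-(k : ℤ)) (rmul (uInv F N 0) (bracket H (u F N 1) b))) := by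
  induction m with
  | zero => simp [invProd_zero, bracket_one_left, rmul_zero]
  | succ m ih =>
    rw [invProd_succ, bracket_mul_left, ih, bracket_S_zpow_left, bracket_uInv_left,
      Finset.sum_range_succ, rmul_add, rmul_neg, rmul_rmul]
    funext n
    simp only [Pi.add_apply, Pi.neg_apply, rmul, lam, map_mul, S_zpow_S_zpow, sub_neg_eq_add]
    ring

theorem bracket_invProd_right (m : ℕ) (a : W F N) :
    bracket H a (invProd F N m) =
      -(invProd F N m • geom m (uInv F N 0 • bracket H a (u F N 1))) := by
  induction m with
  | zero => simp [invProd_zero, bracket_one_right, geom]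
  | succ m ih =>
    rw [invProd_succ, bracket_mul_right, ih, bracket_S_zpow_right, bracket_uInv_right, geom_succ,
      lamS_neg, lamS_smul, lamS_smul, map_mul]
    funext n
    simp only [Pi.add_apply, Pi.neg_apply, Pi.smul_apply, smul_eq_mul]
    ring

theorem bracket_miura_left (j : ℕ) (b : W F N) :
    bracket H (miura F N j) b = rmul (invProd F N j) (bracket H (u F N j) b) -
      rmul (miura F N j) (∑ k ∈ Finset.range j,
        lam (-(k : ℤ)) (rmul (uInv F N 0) (bracket H (u F N 1) b))) := by
  rw [miura, bracket_mul_left, bracket_invProd_left, rmul_neg, rmul_rmul, mul_comm (u F N j)]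
  abel

theorem bracket_miura_right (i : ℕ) (a : W F N) :
    bracket H a (miura F N i) = invProd F N i • bracket H a (u F N i) -
      miura F N i • geom i (uInv F N 0 • bracket H a (u F N 1)) := by
  rw [miura, bracket_mul_right, bracket_invProd_right, smul_neg, smul_smul]
  abel

/-- Including the index N lets v_N = v_1 be treated like the other generators. -/
theorem bracket_u_u_of_le {i j : ℕ}
    (hN : ∀ i ∈ Finset.Icc 1 N, H i N = 0 ∧ H N i = 0)
    (hi : i ∈ Finset.Icc 1 N) (hj : j ∈ Finset.Icc 1 N) :
    bracket H (u F N i) (u F N j) = H i j := by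
  rw [Finset.mem_Icc] at hi hj
  rcases hi.2.eq_or_lt with h | h
  · rw [h, u_self, bracket_one_left, (hN j (by simpa using hj)).2]
  rcases hj.2.eq_or_lt with h' | h'
  · rw [h', u_self, bracket_one_right, (hN i (by simpa using hi)).1]
  exact bracket_u_u H (by simp; omega) (by simp; omega)

end Generators

/-! ### The first bracket -/

section First

variable {F : Type*} [Field F] {N : ℕ}

theorem lamS_const (k : ℤ) (a : W F N) : lamS k (const a) = Pi.single k ((S F N ^ k) a) := by
  rw [const, lamS_single, zero_add]

theorem lam_const (k : ℤ) (a : W F N) : lam k (const a) = Pi.single k a := by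
  rw [const, lam_single, zero_add]

theorem H1_eq (i j : ℕ) : H1 F N i j =
    Pi.single (-(i : ℤ)) ((S F N ^ (-(i : ℤ))) (u F N (i + j))) -
      Pi.single (j : ℤ) (u F N (i + j)) := by
  rw [H1, lamS_const, lam_const]

theorem H1_boundary (i : ℕ) (hi : i ∈ Finset.Icc 1 N) : H1 F N i N = 0 ∧ H1 F N N i = 0 := by
  rw [Finset.mem_Icc] at hi
  constructor <;> simp [H1_eq, u_eq_zero (F := F) (show N < i + N by omega),
    u_eq_zero (F := F) (show N < N + i by omega)]

theorem invProd_mul_S_zpow_neg (i j : ℕ) :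
    invProd F N i * (S F N ^ (-(j : ℤ))) (invProd F N j) =
      (S F N ^ (-(j : ℤ))) (invProd F N (i + j)) := by
  rw [add_comm i, invProd_add, map_mul, S_zpow_S_zpow, neg_add_cancel, S_zpow_zero, mul_comm]

theorem sum_lam_sub (j : ℕ) (f g : ℤ → W F N) :
    ∑ k ∈ Finset.range j, lam (-(k : ℤ)) (f - g) =
      ∑ k ∈ Finset.range j, lam (-(k : ℤ)) f - ∑ k ∈ Finset.range j, lam (-(k : ℤ)) g := by
  rw [← Finset.sum_sub_distrib]
  rfl

/-- The inverses of shifts of u_1 from p_i and p_j join into one block of length i + j for u_{i+j}.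
Those from p_i and the derivative of p_j join into a block of length i + 1 for u_{i+1}. -/
theorem invProd_smul_bracket1 {i j : ℕ} (hi : i ∈ Finset.Icc 1 N) (hj : j ∈ Finset.Icc 1 N) :
    invProd F N i • bracket1 F N (miura F N j) (u F N i) =
      lamS (-j) (const (miura F N (i + j))) - lam i (const (miura F N (i + j))) -
        (lamS (-1) (miura F N (i + 1) • geomInv j (const (miura F N j))) -
          miura F N (i + 1) • lamS i (geomInv j (const (miura F N j)))) := by
  have h1 : 1 ∈ Finset.Icc 1 N := by simp at hi ⊢; omega
  have e1 : invProd F N (i + 1) = invProd F N i * (S F N ^ (i : ℤ)) (uInv F N 0) := by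
    rw [invProd_add, invProd_one]
  have e2 : invProd F N i * (S F N ^ (-1 : ℤ)) (uInv F N 0) =
      (S F N ^ (-1 : ℤ)) (invProd F N (i + 1)) := by
    have := invProd_mul_S_zpow_neg (F := F) (N := N) i 1
    rwa [invProd_one] at this
  rw [bracket1, bracket_miura_left, bracket_u_u_of_le _ H1_boundary hj hi,
    bracket_u_u_of_le _ H1_boundary h1 hi, H1_eq, H1_eq, rmul_sub, rmul_sub, sum_lam_sub, rmul_sub]
  simp only [rmul_single, rmul_sum_lam_single]
  rw [lamS_smul, lamS_const, lam_const, smul_sub, smul_sub, smul_sub, smul_smul,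
    smul_smul, smul_single, smul_single]
  generalize geomInv j (const (miura F N j)) = G
  rw [miura, miura, add_comm j, add_comm 1, Nat.cast_one, map_mul, map_mul, ← e2, e1,
    ← invProd_mul_S_zpow_neg, invProd_add]
  simp only [mul_left_comm (invProd F N i)]

theorem bracket1_miura (hN : 1 ≤ N) {i j : ℕ} (hi : i ∈ Finset.Icc 1 N)
    (hj : j ∈ Finset.Icc 1 N) :
    bracket1 F N (miura F N j) (miura F N i) =
      miura F N i • geom i (lamS (-1) (miura F N 2 • geomInv j (const (miura F N j))) -
          miura F N 2 • lamS 1 (geomInv j (const (miura F N j)))) +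
        miura F N i • geom i (lam 1 (const (miura F N (j + 1))) -
          lamS (-j) (const (miura F N (j + 1)))) +
        (miura F N (i + 1) • lamS i (geomInv j (const (miura F N j))) -
          lamS (-1) (miura F N (i + 1) • geomInv j (const (miura F N j)))) +
        (lamS (-j) (const (miura F N (i + j))) - lam i (const (miura F N (i + j)))) := by
  -- The case i = 1 is the argument of `geom i` in the right Leibniz rule.
  have h := invProd_smul_bracket1 (F := F) (show 1 ∈ Finset.Icc 1 N by simpa using hN) hj
  rw [invProd_one] at h
  rw [bracket1, bracket_miura_right, ← bracket1, invProd_smul_bracket1 hi hj, h, add_comm 1 j, Nat.cast_one,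
    one_add_one_eq_two]
  simp only [geom_sub, smul_sub]
  abel

theorem bracket1_v {i j : ℕ} (hi : i ∈ Finset.Icc 2 N) (hj : j ∈ Finset.Icc 2 N) :
    bracket1 F N (v F N j) (v F N i) =
        v F N i • geom i (mid (geomInv j (const (v F N j)))) +
        v F N i • geom i (lam 1 (const (v F N (j + 1))) - lamS (-j) (const (v F N (j + 1)))) +
        (v F N (i + 1) • lamS i (geomInv j (const (v F N j))) -
          lamS (-1) (v F N (i + 1) • geomInv j (const (v F N j)))) +
        (lamS (-j) (const (v F N (i + j))) - lam i (const (v F N (i + j)))) := by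
  rw [Finset.mem_Icc] at hi hj
  rw [mid, ← miura_eq_v le_rfl, ← miura_eq_v hi.1, ← miura_eq_v hj.1, ← miura_eq_v (by omega),
    ← miura_eq_v (by omega), ← miura_eq_v (by omega)]
  exact bracket1_miura (by omega) (by simp; omega) (by simp; omega)

theorem skew_single (m : ℤ) (a : W F N) :
    skew (Pi.single m a) = -Pi.single (-m) ((S F N ^ (-m)) a) := by
  funext n
  rw [skew, Pi.neg_apply]
  by_cases h : n = -m
  · subst h; simp
  · rw [Pi.single_eq_of_ne (by omega), Pi.single_eq_of_ne h, map_zero]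

theorem skew_sub (f g : ℤ → W F N) : skew (f - g) = skew f - skew g := by
  funext n
  simp only [skew, Pi.sub_apply, map_sub]
  ring

theorem skew_sum {ι : Type*} (s : Finset ι) (f : ι → ℤ → W F N) :
    skew (∑ k ∈ s, f k) = ∑ k ∈ s, skew (f k) := by
  funext n
  simp only [skew, Finset.sum_apply, map_sum, Finset.sum_neg_distrib]

theorem bracket1_skew (a b : W F N) : bracket1 F N a b = skew (bracket1 F N b a) := by
  refine bracket_skew _ (fun i _ j _ => ?_) a b
  rw [H1_eq, H1_eq, skew_sub, skew_single, skew_single, S_zpow_S_zpow, neg_neg, add_neg_cancel,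
    S_zpow_zero, add_comm j i]
  abel

end First

/-! ### Expansions of the rational symbols -/

section Symbol

variable {F : Type*} [Field F]

theorem expand_X (z : LaurentSeries F) (hz : Transcendental F z) : expand z hz RatFunc.X = z := by
  have h := RatFunc.liftAlgHom_apply_div (L := LaurentSeries F) (S := F) (Polynomial.aeval z)
    (nonZeroDivisors_le_comap_nonZeroDivisors_of_injective _
      (transcendental_iff_injective.mp hz)) Polynomial.X 1
  simpa [expand] using h

theorem symbol_mul_X_pow (r : RatFunc F) (k : ℕ) (n : ℤ) :
    symbol (r * RatFunc.X ^ k) n = symbol r (n - k) := by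
  have h1 : posSymbol (r * RatFunc.X ^ k) n = posSymbol r (n - k) := by
    rw [posSymbol, posSymbol, map_mul, map_pow, expand_X, HahnSeries.single_pow, one_pow,
      HahnSeries.coeff_mul_single, mul_one]
    simp
  have h2 : negSymbol (r * RatFunc.X ^ k) n = negSymbol r (n - k) := by
    have h : (HahnSeries.single (1 : ℤ) (1 : F))⁻¹ ^ k = HahnSeries.single (-(k : ℤ)) 1 := by
      rw [HahnSeries.inv_single, inv_one, HahnSeries.single_pow, one_pow]
      simp
    rw [negSymbol, negSymbol, map_mul, map_pow, expand_X, h, HahnSeries.coeff_mul_single, mul_one]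
    congr 1
    ring
  rw [symbol, symbol, h1, h2]

theorem symbol_mul_X_pow_inv (r : RatFunc F) (k : ℕ) (n : ℤ) :
    symbol (r * (RatFunc.X ^ k)⁻¹) n = symbol r (n + k) := by
  have h := symbol_mul_X_pow (r * (RatFunc.X ^ k)⁻¹) k (n + k)
  rw [inv_mul_cancel_right₀ (pow_ne_zero _ RatFunc.X_ne_zero), add_sub_cancel_right] at h
  exact h.symm

theorem symbol_zero (n : ℤ) : symbol (0 : RatFunc F) n = 0 := by
  simp [symbol, posSymbol, negSymbol]

theorem symbol_add (r s : RatFunc F) (n : ℤ) : symbol (r + s) n = symbol r n + symbol s n := by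
  simp only [symbol, posSymbol, negSymbol, map_add, HahnSeries.coeff_add]
  ring

theorem symbol_sub (r s : RatFunc F) (n : ℤ) : symbol (r - s) n = symbol r n - symbol s n := by
  simp only [symbol, posSymbol, negSymbol, map_sub, HahnSeries.coeff_sub]
  ring

theorem symbol_sum {ι : Type*} (s : Finset ι) (r : ι → RatFunc F) (n : ℤ) :
    symbol (∑ k ∈ s, r k) n = ∑ k ∈ s, symbol (r k) n := by
  classical
  induction s using Finset.induction_on with
  | empty => simp [symbol_zero]
  | insert a s ha ih => rw [Finset.sum_insert ha, Finset.sum_insert ha, symbol_add, ih]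

/-- The two expansions of 1 agree, and their half-sum is again 1 since 2 is invertible. -/
theorem symbol_one [CharZero F] (n : ℤ) : symbol (1 : RatFunc F) n = if n = 0 then 1 else 0 := by
  by_cases h : n = 0 <;> simp [symbol, posSymbol, negSymbol, HahnSeries.coeff_one, h]

theorem RatFunc_X_pow_ne_one {k : ℕ} (hk : k ≠ 0) : (RatFunc.X : RatFunc F) ^ k ≠ 1 := by
  intro h
  rw [← RatFunc.algebraMap_X, ← map_pow, ← map_one (algebraMap (Polynomial F) (RatFunc F))] at h
  have h1 := congrArg Polynomial.natDegree (RatFunc.algebraMap_injective F h)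
  rw [Polynomial.natDegree_X_pow, Polynomial.natDegree_one] at h1
  exact hk h1

theorem rat_self (N i : ℕ) : rat F N i N = 0 := by simp [rat]

theorem rat_left_self {N : ℕ} (hN : N ≠ 0) (i : ℕ) :
    rat F N N i = 1 - 1 * RatFunc.X ^ i * (RatFunc.X ^ N)⁻¹ := by
  have h1 : (RatFunc.X : RatFunc F) ^ N - 1 ≠ 0 := sub_ne_zero.mpr (RatFunc_X_pow_ne_one hN)
  have h2 : (RatFunc.X : RatFunc F) ^ N ≠ 0 := pow_ne_zero _ RatFunc.X_ne_zero
  rw [rat]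
  field_simp

/-- Only the factor 1 - X^{-j} depends on j, and it is 1 - X⁻¹ times a geometric sum. The
cancellation of the non-local terms rests on this. -/
theorem rat_eq_sum (N i j : ℕ) :
    rat F N j i = ∑ k ∈ Finset.range j, rat F N 1 i * (RatFunc.X ^ k)⁻¹ := by
  have h : (1 : RatFunc F) - (RatFunc.X ^ j)⁻¹ =
      (1 - RatFunc.X⁻¹) * ∑ k ∈ Finset.range j, (RatFunc.X ^ k)⁻¹ := by
    rw [← inv_pow]
    simp_rw [← inv_pow]
    rw [mul_comm, geom_sum_mul_neg]
  rw [← Finset.mul_sum, rat, rat, h, pow_one]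
  ring

theorem symbol_rat_eq_sum (N i j : ℕ) (n : ℤ) :
    symbol (rat F N j i) n = ∑ k ∈ Finset.range j, symbol (rat F N 1 i) (n + k) := by
  rw [rat_eq_sum, symbol_sum]
  exact Finset.sum_congr rfl fun k _ => symbol_mul_X_pow_inv _ _ _

end Symbol

/-! ### The second bracket -/

section Second

variable {F : Type*} [Field F] {N : ℕ}

/-- The series `(∑_{n=1}^j - ∑_{n=i}^{i+j-1}) t_n (λS)ⁿ⁻ⁱ t_{i+j-n}`. -/
def quad (t : ℕ → W F N) (i j : ℕ) : ℤ → W F N :=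
  (∑ n ∈ Finset.Icc 1 j, t n • lamS ((n : ℤ) - i) (const (t (i + j - n)))) -
    ∑ n ∈ Finset.Icc i (i + j - 1), t n • lamS ((n : ℤ) - i) (const (t (i + j - n)))

theorem H2_eq (i j : ℕ) :
    H2 F N i j = quad (u F N) i j + u F N j • act (symbol (rat F N i j)) (u F N i) := rfl

theorem quad_one_left (t : ℕ → W F N) (i : ℕ) : quad t 1 i = 0 := by
  rw [quad, Nat.add_sub_cancel_left, sub_self]

theorem quad_one_right (t : ℕ → W F N) (j : ℕ) :
    quad t j 1 = t 1 • lamS (1 - j) (const (t j)) - t j • const (t 1) := by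
  simp [quad, lamS_zero]

/-- Dropping the terms with an index above N reduces both sums to j ≤ n ≤ N. -/
theorem quad_self_right {t : ℕ → W F N} (ht : ∀ n, N < n → t n = 0) {j : ℕ} (hj : 1 ≤ j) :
    quad t j N = 0 := by
  rw [quad, sub_eq_zero]
  trans ∑ n ∈ Finset.Icc j N, t n • lamS ((n : ℤ) - j) (const (t (j + N - n)))
  · symm
    refine Finset.sum_subset (Finset.Icc_subset_Icc_left hj) fun n hn hn' => ?_
    rw [Finset.mem_Icc] at hn hn'
    rw [ht (j + N - n) (by omega), const_zero, lamS_zero_right, smul_zero]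
  · refine Finset.sum_subset (Finset.Icc_subset_Icc_right (by omega)) fun n hn hn' => ?_
    rw [Finset.mem_Icc] at hn hn'
    rw [ht n (by omega), zero_smul]

theorem quad_self_left {t : ℕ → W F N} (ht : ∀ n, N < n → t n = 0) {i : ℕ} (hi : 1 ≤ i) :
    quad t N i = t i • lamS ((i : ℤ) - N) (const (t N)) - t N • const (t i) := by
  rw [quad, Finset.sum_eq_single_of_mem i (by simp; omega) fun n hn hn' => ?_,
    Finset.sum_eq_single_of_mem N (by simp; omega) fun n hn hn' => ?_]
  · simp [lamS_zero]
  · rw [Finset.mem_Icc] at hn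
    rw [ht n (by omega), zero_smul]
  · rw [Finset.mem_Icc] at hn
    rw [ht (N + i - n) (by omega), const_zero, lamS_zero_right, smul_zero]

/-- With N on the right both parts vanish separately. With N on the left the rational symbol
collapses to 1 - z^{i-N}, which cancels the two surviving quadratic terms. -/
theorem H2_boundary [CharZero F] (i : ℕ) (hi : i ∈ Finset.Icc 1 N) :
    H2 F N i N = 0 ∧ H2 F N N i = 0 := by
  rw [Finset.mem_Icc] at hi
  have hu : ∀ n, N < n → u F N n = 0 := fun n hn => u_eq_zero hn
  constructor
  · rw [H2_eq, quad_self_right hu hi.1, rat_self]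
    funext n
    simp [act, symbol_zero]
  · rw [H2_eq, quad_self_left hu hi.1, rat_left_self (by omega), u_self]
    funext n
    simp only [Pi.add_apply, Pi.sub_apply, Pi.smul_apply, act, symbol_sub, symbol_mul_X_pow_inv,
      symbol_mul_X_pow, symbol_one, const, lamS_single, map_one, one_smul, zero_add,
      Pi.single_apply, smul_eq_mul, Pi.zero_apply]
    have e : n + (N : ℤ) - i = 0 ↔ n = i - N := by omega
    simp only [e]
    split_ifs <;> simp

/-- Both sides multiply S^k(u_1)⁻¹ over the same multiset of k: the intervals [0, i) and [n-j, n) on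
the left, [0, n) and [n-j, i) on the right. -/
theorem invProd_mul_S_zpow (i j n : ℕ) (hn : n ≤ i + j) :
    invProd F N i * (S F N ^ ((n : ℤ) - j)) (invProd F N j) =
      invProd F N n * (S F N ^ ((n : ℤ) - j)) (invProd F N (j + i - n)) := by
  rcases le_total n i with h | h
  · obtain ⟨k, rfl⟩ := Nat.exists_eq_add_of_le h
    rw [show j + (n + k) - n = j + k by omega, invProd_add, invProd_add j, map_mul, S_zpow_S_zpow,
      sub_add_cancel]
    ring
  · obtain ⟨k, rfl⟩ := Nat.exists_eq_add_of_le h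
    obtain ⟨l, rfl⟩ := Nat.exists_eq_add_of_le (Nat.le_of_add_le_add_left hn)
    rw [show k + l + i - (i + k) = l by omega, add_comm k l, invProd_add i, invProd_add l, map_mul,
      S_zpow_S_zpow]
    push_cast
    rw [show (i : ℤ) + k - (l + k) + l = i by ring]
    ring

theorem invProd_smul_rmul_quad {i j : ℕ} (hj : 1 ≤ j) :
    invProd F N i • rmul (invProd F N j) (quad (u F N) j i) = quad (miura F N) j i := by
  have h : ∀ n ≤ i + j, invProd F N i • rmul (invProd F N j)
      (u F N n • lamS ((n : ℤ) - j) (const (u F N (j + i - n)))) =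
      miura F N n • lamS ((n : ℤ) - j) (const (miura F N (j + i - n))) := by
    intro n hn
    have := invProd_mul_S_zpow (F := F) (N := N) i j n hn
    simp only [const, lamS_single, smul_single, rmul_single, zero_add, miura, map_mul]
    congr 1
    linear_combination (u F N n * (S F N ^ ((n : ℤ) - j)) (u F N (j + i - n))) * this
  rw [quad, quad, rmul_sub, smul_sub, rmul_sum, rmul_sum, Finset.smul_sum, Finset.smul_sum]
  congr 1
  · refine Finset.sum_congr rfl fun n hn => h n ?_
    rw [Finset.mem_Icc] at hn
    omega
  · refine Finset.sum_congr rfl fun n hn => h n ?_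
    rw [Finset.mem_Icc] at hn
    omega

theorem invProd_smul_bracket2 [CharZero F] {i j : ℕ} (hi : i ∈ Finset.Icc 1 N)
    (hj : j ∈ Finset.Icc 1 N) :
    invProd F N i • bracket2 F N (miura F N j) (u F N i) = quad (miura F N) j i := by
  have h1 : 1 ∈ Finset.Icc 1 N := by simp at hi ⊢; omega
  rw [bracket2, bracket_miura_left, bracket_u_u_of_le _ H2_boundary hj hi,
    bracket_u_u_of_le _ H2_boundary h1 hi, H2_eq, H2_eq, quad_one_left, zero_add, rmul_add,
    ← invProd_smul_rmul_quad (Finset.mem_Icc.mp hj).1, add_sub_assoc, smul_add, add_eq_left]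
  -- What remains is the non-local part of {u_j λ u_i} minus the term from differentiating p_j. They
  -- agree summand by summand through `symbol_rat_eq_sum`.
  rw [sub_eq_zero.mpr, smul_zero]
  funext n
  simp only [rmul_smul, Pi.smul_apply, Finset.sum_apply, rmul, lam, act,
    symbol_rat_eq_sum N i j, smul_eq_mul, sub_neg_eq_add, miura, map_mul, Finset.sum_smul,
    Finset.mul_sum, Finset.sum_mul]
  refine Finset.sum_congr rfl fun k _ => ?_
  have h2 := congrArg (S F N ^ (n + k)) (u_one_mul_uInv (F := F) (N := N))
  rw [map_mul, map_one] at h2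
  simp only [Algebra.smul_def]
  linear_combination (-u F N i * algebraMap F (W F N) (symbol (rat F N 1 i) (n + k)) *
    (S F N ^ n) (u F N j) * (S F N ^ n) (invProd F N j)) * h2

theorem bracket2_miura [CharZero F] {i j : ℕ} (hi : i ∈ Finset.Icc 1 N)
    (hj : j ∈ Finset.Icc 1 N) :
    bracket2 F N (miura F N j) (miura F N i) =
      miura F N i • geom i (const (miura F N j) - lamS (1 - j) (const (miura F N j))) +
        quad (miura F N) j i := by
  have h := invProd_smul_bracket2 (F := F) (show 1 ∈ Finset.Icc 1 N by simp at hi ⊢; omega) hj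
  have h1 : miura F N j • const (1 : W F N) = const (miura F N j) := by
    rw [const, smul_single, mul_one, const]
  rw [invProd_one, quad_one_right, miura_one, one_smul, h1] at h
  rw [bracket2, bracket_miura_right, ← bracket2, invProd_smul_bracket2 hi hj, h]
  simp only [geom_sub, smul_sub]
  abel

theorem bracket2_v [CharZero F] {i j : ℕ} (hi : i ∈ Finset.Icc 2 N) (hj : j ∈ Finset.Icc 2 N) :
    bracket2 F N (v F N j) (v F N i) =
      v F N i • geom i (const (v F N j) - lamS (1 - j) (const (v F N j))) +
        quad (miura F N) j i := by
  rw [Finset.mem_Icc] at hi hj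
  rw [← miura_eq_v hi.1, ← miura_eq_v hj.1]
  exact bracket2_miura (by simp; omega) (by simp; omega)

theorem miura_eq_zero (n : ℕ) (hn : N < n) : miura F N n = 0 := by
  rw [miura, u_eq_zero hn, zero_mul]

theorem bracket2_v_last [CharZero F] {j : ℕ} (hj : j ∈ Finset.Icc 2 N) :
    bracket2 F N (v F N j) (v F N N) =
      v F N N • geom N (const (v F N j) - lamS (1 - j) (const (v F N j))) := by
  rw [bracket2_v (by simp at hj ⊢; omega) hj, quad_self_right miura_eq_zero (by simp at hj; omega),
    add_zero]

/-- Isolates the terms n = 1 and n = i + j - 1 of `quad`, where m_1 = 1 makes the expression linear.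
The remaining correction f(i) - f(j) is cancelled by `geom_succ_sub`. -/
theorem sum_Icc_sub_sum_Icc {M : Type*} [AddCommGroup M] (f : ℕ → M) {i j : ℕ} (hi : 2 ≤ i)
    (hj : 2 ≤ j) :
    ∑ n ∈ Finset.Icc 1 i, f n - ∑ n ∈ Finset.Icc j (j + i - 1), f n =
      f 1 - f (i + j - 1) + (∑ n ∈ Finset.Icc 2 j, f n - ∑ n ∈ Finset.Icc i (i + j - 2), f n) +
        (f i - f j) := by
  have h : ∀ a b, a ≤ b + 1 → ∑ n ∈ Finset.Icc a b, f n =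
      ∑ n ∈ Finset.range (b + 1), f n - ∑ n ∈ Finset.range a, f n := fun a b hab => by
    rw [← Finset.sum_Ico_eq_sub f hab]
    rfl
  obtain ⟨k, rfl⟩ := Nat.exists_eq_add_of_le hi
  rw [h _ _ (by omega), h _ _ (by omega), h _ _ (by omega), h _ _ (by omega),
    show j + (2 + k) - 1 = j + k + 1 by omega, show 2 + k + j - 2 = j + k by omega,
    show 2 + k + j - 1 = j + k + 1 by omega, Finset.sum_range_succ f (j + k + 1),
    Finset.sum_range_succ f j, Finset.sum_range_succ f (2 + k), Finset.sum_range_succ f 1]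
  abel

/-- With z = λS, 1 + ⋯ + z^m times 1 - z^{1-j} equals z(1 + ⋯ + z^{m-1})(1 - z^{-j}) plus 1 -
z^{m+1-j}. -/
theorem geom_succ_sub (m : ℕ) (j : ℤ) (f : ℤ → W F N) :
    geom (m + 1) (f - lamS (1 - j) f) =
      lamS 1 (geom m (f - lamS (-j) f)) + (f - lamS (m + 1 - j) f) := by
  induction m with
  | zero => simp [geom, lamS_sub, lamS_lamS, lamS_zero, lamS_zero_right]
  | succ m ih =>
    rw [geom_succ, ih, geom_succ, lamS_add, lamS_lamS, lamS_sub, lamS_sub, lamS_lamS, lamS_lamS]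
    push_cast
    rw [show (m : ℤ) + 1 + (1 - j) = m + 1 + 1 - j by ring, add_comm 1 (m : ℤ), ← sub_eq_add_neg]
    abel

theorem sum_Icc_reflect (t : ℕ → W F N) (i j a b : ℕ) (ha : a ≤ i + j) (hb : b ≤ i + j) :
    ∑ p ∈ Finset.Icc a b, t (i + j - p) • lamS ((i : ℤ) - p) (const (t p)) =
      ∑ n ∈ Finset.Icc (i + j - b) (i + j - a),
        t n • lamS ((n : ℤ) - j) (const (t (j + i - n))) := by
  refine Finset.sum_nbij' (fun p => i + j - p) (fun p => i + j - p) ?_ ?_ ?_ ?_ ?_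
  · intro p hp; simp only [Finset.mem_Icc] at hp ⊢; omega
  · intro p hp; simp only [Finset.mem_Icc] at hp ⊢; omega
  · intro p hp; simp only [Finset.mem_Icc] at hp; omega
  · intro p hp; simp only [Finset.mem_Icc] at hp; omega
  · intro p hp
    simp only [Finset.mem_Icc] at hp
    rw [show j + i - (i + j - p) = p by omega, Nat.cast_sub (by omega)]
    push_cast
    congr 2
    ring

/-- No bound on i + j is needed: the formula for large i + j is this one with the vanishing terms
removed. -/
theorem bracket2_v' [CharZero F] {i j : ℕ} (hi : i ∈ Finset.Icc 2 N) (hj : j ∈ Finset.Icc 2 N) :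
    bracket2 F N (v F N j) (v F N i) =
        v F N i • lamS 1 (geom (i - 1) (const (v F N j) - lamS (-j) (const (v F N j)))) -
        ((∑ p ∈ Finset.Icc 2 j,
            v F N (i + j - p) • lamS ((i : ℤ) - p) (const (v F N p))) -
          ∑ p ∈ Finset.Icc i (i + j - 2),
            v F N (i + j - p) • lamS ((i : ℤ) - p) (const (v F N p))) +
        (lamS (1 - j) (const (v F N (i + j - 1))) -
          lam ((i : ℤ) - 1) (const (v F N (i + j - 1)))) := by
  rw [bracket2_v hi hj]
  rw [Finset.mem_Icc] at hi hj
  have hs : ∀ a b, 2 ≤ a → b + 2 ≤ i + j →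
      ∑ p ∈ Finset.Icc a b, v F N (i + j - p) • lamS ((i : ℤ) - p) (const (v F N p)) =
      ∑ p ∈ Finset.Icc a b, miura F N (i + j - p) • lamS ((i : ℤ) - p) (const (miura F N p)) := by
    intro a b ha hb
    refine Finset.sum_congr rfl fun p hp => ?_
    rw [Finset.mem_Icc] at hp
    rw [miura_eq_v (by omega), miura_eq_v (by omega)]
  rw [hs _ _ le_rfl (by omega), hs _ _ hi.1 (by omega), ← miura_eq_v hi.1, ← miura_eq_v hj.1,
    ← miura_eq_v (by omega), quad, sum_Icc_sub_sum_Icc _ hi.1 hj.1,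
    sum_Icc_reflect _ i j 2 j (by omega) (by omega),
    sum_Icc_reflect _ i j i (i + j - 2) (by omega) (by omega), Nat.add_sub_cancel,
    Nat.add_sub_cancel_left, show i + j - (i + j - 2) = 2 by omega]
  obtain ⟨m, rfl⟩ : ∃ m, i = m + 1 := ⟨i - 1, by omega⟩
  have e1 : miura F N (m + 1 + j - 1) • const (1 : W F N) = const (miura F N (m + 1 + j - 1)) := by
    rw [const, smul_single, mul_one, const]
  have e2 : miura F N j • const (miura F N (m + 1)) = miura F N (m + 1) • const (miura F N j) := by
    rw [const, const, smul_single, smul_single, mul_comm]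
  have e3 : miura F N (m + 1 + j - 1) • lamS m (const (1 : W F N)) =
      lam m (const (miura F N (m + 1 + j - 1))) := by
    rw [const, const, lamS_single, lam_single, smul_single, map_one, mul_one]
  rw [Nat.add_sub_cancel, geom_succ_sub, show j + (m + 1) - 1 = m + 1 + j - 1 by omega,
    show j + (m + 1) - (m + 1 + j - 1) = 1 by omega, Nat.add_sub_cancel, Nat.add_sub_cancel_left,
    miura_one, one_smul, sub_self, lamS_zero, e2,
    show ((m + 1 + j - 1 : ℕ) : ℤ) - j = m by omega, e3]
  push_cast
  rw [add_sub_cancel_right]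
  simp only [smul_add, smul_sub]
  abel

theorem bracket2_v_of_le [CharZero F] {i j : ℕ} (hi : i ∈ Finset.Icc 2 N)
    (hj : j ∈ Finset.Icc 2 N) (hij : N + 2 ≤ i + j) :
    bracket2 F N (v F N j) (v F N i) =
        v F N i • lamS 1 (geom (i - 1) (const (v F N j) - lamS (-j) (const (v F N j)))) -
        ((∑ p ∈ Finset.Icc (i + j - N) j,
            v F N (i + j - p) • lamS ((i : ℤ) - p) (const (v F N p))) -
          ∑ p ∈ Finset.Icc i N,
            v F N (i + j - p) • lamS ((i : ℤ) - p) (const (v F N p))) := by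
  rw [bracket2_v' hi hj]
  rw [Finset.mem_Icc] at hi hj
  rw [v_eq_zero (m := i + j - 1) (by omega) (by omega), const_zero, lamS_zero_right, lam_zero_right, sub_zero, add_zero]
  congr 2
  · symm
    refine Finset.sum_subset (Finset.Icc_subset_Icc_left (by omega)) fun p hp hp' => ?_
    rw [Finset.mem_Icc] at hp hp'
    rw [v_eq_zero (m := i + j - p) (by omega) (by omega), zero_smul]
  · symm
    refine Finset.sum_subset (Finset.Icc_subset_Icc_right (by omega)) fun p hp hp' => ?_
    rw [Finset.mem_Icc] at hp hp'
    rw [v_eq_zero (m := p) (by omega) (by omega), const_zero, lamS_zero_right, smul_zero]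

/-- An identity of Laurent polynomials in z, with φ(e) in place of z^e: both sides equal (z - z^i -
z^{1-n} + z^{i-n}) / (1 - z). -/
theorem sum_range_telescope {M : Type*} [AddCommGroup M] (φ : ℤ → M) (i n : ℕ) :
    ∑ k ∈ Finset.range i, (φ k - φ (k + (1 - n))) + (φ (i - n) - φ 0) =
      ∑ k ∈ Finset.range n, (φ (i - 1 - k) - φ (-k)) := by
  have h : ∀ a : ℤ, ∑ k ∈ Finset.range n, (φ (a - k) - φ (a - 1 - k)) = φ a - φ (a - n) := by
    intro a
    have h1 := Finset.sum_range_sub' (fun k : ℕ => φ (a - k)) n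
    simp only [Nat.cast_zero, sub_zero] at h1
    rw [← h1]
    refine Finset.sum_congr rfl fun k _ => ?_
    push_cast
    rw [sub_sub, add_comm 1]
  induction i with
  | zero =>
    have h0 := h 0
    simp only [zero_sub] at h0
    rw [Finset.sum_range_zero, zero_add, Nat.cast_zero, zero_sub, ← neg_sub, ← h0,
      ← Finset.sum_neg_distrib]
    refine Finset.sum_congr rfl fun k _ => ?_
    rw [neg_sub, zero_sub]
  | succ i ih =>
    have hi := h i
    rw [Finset.sum_sub_distrib] at hi ih ⊢
    rw [Finset.sum_sub_distrib] at ih ⊢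
    rw [Finset.sum_range_succ, Finset.sum_range_succ]
    push_cast
    rw [add_sub_cancel_right]
    rw [sub_eq_iff_eq_add] at hi
    rw [hi, show (i : ℤ) + 1 - n = i + (1 - n) by ring]
    rw [eq_sub_iff_add_eq] at ih
    rw [← sub_eq_zero] at ih ⊢
    rw [← ih]
    abel

theorem skew_smul_lamS_const (a b : W F N) (k : ℤ) :
    skew (a • lamS k (const b)) = -(b • lamS (-k) (const a)) := by
  rw [const, const, lamS_single, lamS_single, smul_single, smul_single, skew_single, map_mul,
    S_zpow_S_zpow, zero_add, zero_add, neg_add_cancel, S_zpow_zero, mul_comm]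

/-- Skew-symmetry is read off the explicit local formulas, so that of `H2`, with its rational
symbol, is not required. -/
theorem bracket2_v_skew [CharZero F] {i : ℕ} (hi : i ∈ Finset.Icc 2 N) :
    bracket2 F N (v F N N) (v F N i) = skew (bracket2 F N (v F N i) (v F N N)) := by
  have hi' := Finset.mem_Icc.mp hi
  have hN : N ∈ Finset.Icc 2 N := by simp; omega
  rw [bracket2_v hi hN, quad_self_left miura_eq_zero (by omega), bracket2_v_last hi,
    miura_eq_v hi'.1, miura_eq_v (by omega)]
  have h := sum_range_telescope (fun e => v F N i • lamS e (const (v F N N))) i N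
  have e0 : v F N N • const (v F N i) = v F N i • lamS 0 (const (v F N N)) := by
    rw [lamS_zero, const, const, smul_single, smul_single, mul_comm]
  rw [e0, geom, Finset.smul_sum, geom, Finset.smul_sum, skew_sum]
  refine Eq.trans ?_ (h.trans ?_)
  · congr 1
    refine Finset.sum_congr rfl fun k _ => ?_
    rw [lamS_sub, lamS_lamS, smul_sub]
  · refine Finset.sum_congr rfl fun k _ => ?_
    rw [lamS_sub, lamS_lamS, smul_sub, skew_sub, skew_smul_lamS_const, skew_smul_lamS_const,
      show -((k : ℤ) + (1 - i)) = i - 1 - k by ring]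
    abel

end Second

/-! ### Locality on A_N -/

section Local

variable {F : Type*} [Field F] {N : ℕ}

/-- A Laurent polynomial in `λ` with coefficients in the algebra generated by the Miura elements. -/
def IsLocalSeries (f : ℤ → W F N) : Prop :=
  (∀ n, f n ∈ A F N) ∧ {n | f n ≠ 0}.Finite

theorem S_zpow_v_mem {i : ℕ} (hi : i ∈ Finset.Ico 1 N) (k : ℤ) :
    (S F N ^ k) (v F N i) ∈ A F N :=
  Algebra.subset_adjoin ⟨i, hi, k, rfl⟩

theorem v_mem (hN : 2 ≤ N) {i : ℕ} (hi : 2 ≤ i) : v F N i ∈ A F N := by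
  rcases lt_trichotomy i N with h | h | h
  · simpa using S_zpow_v_mem (F := F) (i := i) (by simp; omega) 0
  · rw [h, ← v_one]
    simpa using S_zpow_v_mem (F := F) (N := N) (i := 1) (by simp; omega) 0
  · rw [v_eq_zero hi h]
    exact zero_mem _

theorem miura_mem (hN : 2 ≤ N) {i : ℕ} (hi : 1 ≤ i) : miura F N i ∈ A F N := by
  rcases hi.eq_or_lt with h | h
  · rw [← h, miura_one]
    exact one_mem _
  · rw [miura_eq_v h]
    exact v_mem hN h

theorem S_zpow_mem {a : W F N} (ha : a ∈ A F N) (k : ℤ) : (S F N ^ k) a ∈ A F N := by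
  induction ha using Algebra.adjoin_induction with
  | mem x hx =>
    obtain ⟨i, hi, n, rfl⟩ := hx
    rw [S_zpow_S_zpow]
    exact S_zpow_v_mem hi _
  | algebraMap r =>
    rw [AlgEquiv.commutes]
    exact algebraMap_mem _ _
  | add x y _ _ hx hy =>
    rw [map_add]
    exact add_mem hx hy
  | mul x y _ _ hx hy =>
    rw [map_mul]
    exact mul_mem hx hy

namespace IsLocalSeries

variable {f g : ℤ → W F N}

theorem zero : IsLocalSeries (0 : ℤ → W F N) :=
  ⟨fun _ => zero_mem _, by simp⟩

theorem add (hf : IsLocalSeries f) (hg : IsLocalSeries g) : IsLocalSeries (f + g) := by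
  refine ⟨fun n => add_mem (hf.1 n) (hg.1 n), (hf.2.union hg.2).subset fun n hn => ?_⟩
  by_contra h
  simp only [Set.mem_union, Set.mem_ofPred_eq, not_or, not_not] at h
  exact hn (by simp [h])

theorem sub (hf : IsLocalSeries f) (hg : IsLocalSeries g) : IsLocalSeries (f - g) := by
  refine ⟨fun n => sub_mem (hf.1 n) (hg.1 n), (hf.2.union hg.2).subset fun n hn => ?_⟩
  by_contra h
  simp only [Set.mem_union, Set.mem_ofPred_eq, not_or, not_not] at h
  exact hn (by simp [h])

theorem sum {ι : Type*} {s : Finset ι} {f : ι → ℤ → W F N} (h : ∀ i ∈ s, IsLocalSeries (f i)) :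
    IsLocalSeries (∑ i ∈ s, f i) := by
  classical
  induction s using Finset.induction_on with
  | empty => exact zero
  | insert a s ha ih =>
    rw [Finset.sum_insert ha]
    exact (h a (Finset.mem_insert_self _ _)).add
      (ih fun i hi => h i (Finset.mem_insert_of_mem hi))

theorem smul {a : W F N} (ha : a ∈ A F N) (hf : IsLocalSeries f) : IsLocalSeries (a • f) :=
  ⟨fun n => mul_mem ha (hf.1 n), hf.2.subset fun n hn h => hn (by simp [h])⟩

theorem rmul {a : W F N} (ha : a ∈ A F N) (hf : IsLocalSeries f) : IsLocalSeries (rmul a f) :=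
  ⟨fun n => mul_mem (hf.1 n) (S_zpow_mem ha n), hf.2.subset fun n hn h =>
    hn (by simp [MultW.rmul, h])⟩

theorem lam (hf : IsLocalSeries f) (k : ℤ) : IsLocalSeries (lam k f) :=
  ⟨fun n => hf.1 (n - k), hf.2.preimage (sub_left_injective.injOn)⟩

theorem lamS (hf : IsLocalSeries f) (k : ℤ) : IsLocalSeries (lamS k f) :=
  ⟨fun n => S_zpow_mem (hf.1 (n - k)) k, (hf.lam k).2.subset fun n hn h =>
    hn (by rw [MultW.lam] at h; rw [MultW.lamS, h, map_zero])⟩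

theorem const {a : W F N} (ha : a ∈ A F N) : IsLocalSeries (const a) := by
  constructor
  · intro n
    by_cases h : n = 0
    · subst h; simpa [MultW.const] using ha
    · simp [MultW.const, h]
  · refine (Set.finite_singleton 0).subset fun n hn => ?_
    by_contra h
    exact hn (by simp [MultW.const, Pi.single_eq_of_ne h])

theorem geom (hf : IsLocalSeries f) (m : ℕ) : IsLocalSeries (geom m f) :=
  sum fun k _ => hf.lamS k

theorem geomInv (hf : IsLocalSeries f) (m : ℕ) : IsLocalSeries (geomInv m f) :=
  sum fun k _ => hf.lamS (-k)

theorem mid (hN : 2 ≤ N) (hf : IsLocalSeries f) : IsLocalSeries (mid f) :=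
  ((smul (v_mem hN le_rfl) hf).lamS _).sub (smul (v_mem hN le_rfl) (hf.lamS _))

end IsLocalSeries

theorem isLocalSeries_bracket1_v {i j : ℕ} (hi : i ∈ Finset.Icc 2 N) (hj : j ∈ Finset.Icc 2 N) :
    IsLocalSeries (bracket1 F N (v F N j) (v F N i)) := by
  rw [bracket1_v hi hj]
  rw [Finset.mem_Icc] at hi hj
  have hN : 2 ≤ N := hi.1.trans hi.2
  have hv {k : ℕ} (hk : 2 ≤ k) : v F N k ∈ A F N := v_mem hN hk
  have hc {k : ℕ} (hk : 2 ≤ k) : IsLocalSeries (const (v F N k)) := .const (hv hk)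
  exact (((((((hc hj.1).geomInv j).mid hN).geom i).smul (hv hi.1)).add
    (((((hc (by omega)).lam 1).sub ((hc (by omega)).lamS (-j))).geom i).smul (hv hi.1))).add
    (((((hc hj.1).geomInv j).lamS i).smul (hv (by omega))).sub
      ((((hc hj.1).geomInv j).smul (hv (by omega))).lamS (-1)))).add
    (((hc (by omega)).lamS (-j)).sub ((hc (by omega)).lam i))

theorem isLocalSeries_quad (hN : 2 ≤ N) {i j : ℕ} (hi : 1 ≤ i) :
    IsLocalSeries (quad (miura F N) i j) := by
  refine .sub (.sum fun n hn => ?_) (.sum fun n hn => ?_) <;> rw [Finset.mem_Icc] at hn <;>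
  exact .smul (miura_mem hN (by omega)) ((IsLocalSeries.const (miura_mem hN (by omega))).lamS _)

theorem isLocalSeries_bracket2_v [CharZero F] {i j : ℕ} (hi : i ∈ Finset.Icc 2 N)
    (hj : j ∈ Finset.Icc 2 N) : IsLocalSeries (bracket2 F N (v F N j) (v F N i)) := by
  rw [bracket2_v hi hj]
  rw [Finset.mem_Icc] at hi hj
  have hN : 2 ≤ N := hi.1.trans hi.2
  have hc : IsLocalSeries (const (v F N j)) := .const (v_mem hN hj.1)
  exact (((hc.sub (hc.lamS _)).geom i).smul (v_mem hN hi.1)).add (isLocalSeries_quad hN (by omega))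

/-- Local series are stable under every operation in the Leibniz and sesquilinearity rules, so
induction on both arguments reduces to generators. Indices 2 to N suffice because v_1 = v_N. -/
theorem isLocalOn_of_generators (H : ℕ → ℕ → ℤ → W F N)
    (h : ∀ i ∈ Finset.Icc 2 N, ∀ j ∈ Finset.Icc 2 N,
      IsLocalSeries (bracket H (v F N j) (v F N i))) :
    IsLocalOn (bracket H) (A F N) := by
  have hv : ∀ i ∈ Finset.Ico 1 N, ∃ k ∈ Finset.Icc 2 N, v F N i = v F N k := by
    intro i hi
    rw [Finset.mem_Ico] at hi
    rcases hi.1.eq_or_lt with h1 | h1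
    · exact ⟨N, by simp; omega, by rw [← h1, v_one]⟩
    · exact ⟨i, by simp; omega, rfl⟩
  intro a ha b hb
  change IsLocalSeries (bracket H a b)
  induction ha using Algebra.adjoin_induction with
  | mem x hx =>
    obtain ⟨j, hj, m, rfl⟩ := hx
    obtain ⟨j', hj', hjj⟩ := hv j hj
    rw [bracket_S_zpow_left, hjj]
    refine IsLocalSeries.lam ?_ _
    induction hb using Algebra.adjoin_induction with
    | mem y hy =>
      obtain ⟨i, hi, n, rfl⟩ := hy
      obtain ⟨i', hi', hii⟩ := hv i hi
      rw [bracket_S_zpow_right, hii]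
      exact (h i' hi' j' hj').lamS _
    | algebraMap r => rw [bracket_algebraMap_right]; exact .zero
    | add y z _ _ hy hz => rw [bracket_add_right]; exact hy.add hz
    | mul y z hy' hz' hy hz => rw [bracket_mul_right]; exact (hz.smul hy').add (hy.smul hz')
  | algebraMap r => rw [bracket_algebraMap_left]; exact .zero
  | add x y _ _ hx hy => rw [bracket_add_left]; exact hx.add hy
  | mul x y hx' hy' hx hy => rw [bracket_mul_left]; exact (hy.rmul hx').add (hx.rmul hy')

/-- At i = N the terms with v_{N+1} and v_{N+j} drop out. -/
theorem bracket1_v_last {j : ℕ} (hj : j ∈ Finset.Icc 2 N) :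
    bracket1 F N (v F N j) (v F N N) =
      v F N N • geom N (mid (geomInv j (const (v F N j)))) +
        v F N N • geom N (lam 1 (const (v F N (j + 1))) - lamS (-j) (const (v F N (j + 1)))) := by
  rw [bracket1_v (by simp at hj ⊢; omega) hj]
  rw [Finset.mem_Icc] at hj
  rw [v_eq_zero (m := N + 1) (by omega) (by omega), v_eq_zero (m := N + j) (by omega) (by omega),
    const_zero, zero_smul, zero_smul, lamS_zero_right, lamS_zero_right, lam_zero_right]
  simp

theorem bracket1_v_last_last (hN : 2 ≤ N) :
    bracket1 F N (v F N N) (v F N N) =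
      v F N N • geom N (mid (geomInv N (const (v F N N)))) := by
  rw [bracket1_v_last (by simpa using hN), v_eq_zero (m := N + 1) (by omega) (by omega), const_zero,
    lam_zero_right]
  funext n
  simp [geom, lamS, Finset.sum_apply]

end Local

end MultW

end

/-! ### Assembly, with v_1 rewritten as v_N -/

theorem mainTheorem1 (F : Type*) [Field F] [CharZero F] (N : ℕ) (hN : 3 ≤ N) :
    -- both brackets restrict to local brackets on the subalgebra
    IsLocalOn (bracket1 F N) (A F N) ∧
    IsLocalOn (bracket2 F N) (A F N) ∧
    -- the first bracket on the generators
    bracket1 F N (v F N 1) (v F N 1) =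
      v F N 1 • geom N (mid (geomInv N (const (v F N 1)))) ∧
    (∀ j ∈ Finset.Icc 2 (N - 1),
      bracket1 F N (v F N j) (v F N 1) =
        v F N 1 • geom N (mid (geomInv j (const (v F N j)))) +
        v F N 1 • geom N (lam 1 (const (v F N (j + 1))) - lamS (-j) (const (v F N (j + 1))))) ∧
    (∀ i ∈ Finset.Icc 2 (N - 1), ∀ j ∈ Finset.Icc 2 (N - 1),
      bracket1 F N (v F N j) (v F N i) =
        v F N i • geom i (mid (geomInv j (const (v F N j)))) +
        v F N i • geom i (lam 1 (const (v F N (j + 1))) - lamS (-j) (const (v F N (j + 1)))) +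
        (v F N (i + 1) • lamS i (geomInv j (const (v F N j))) -
          lamS (-1) (v F N (i + 1) • geomInv j (const (v F N j)))) +
        (lamS (-j) (const (v F N (i + j))) - lam i (const (v F N (i + j))))) ∧
    (∀ j ∈ Finset.Icc 2 (N - 1),
      bracket1 F N (v F N 1) (v F N j) = skew (bracket1 F N (v F N j) (v F N 1))) ∧
    -- the second bracket on the generators
    bracket2 F N (v F N 1) (v F N 1) =
      v F N 1 • geom N (const (v F N 1) - lamS (1 - N) (const (v F N 1))) ∧
    (∀ j ∈ Finset.Icc 2 (N - 1),
      bracket2 F N (v F N j) (v F N 1) =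
        v F N 1 • geom N (const (v F N j) - lamS (1 - j) (const (v F N j)))) ∧
    (∀ i ∈ Finset.Icc 2 (N - 1), ∀ j ∈ Finset.Icc 2 (N - 1), i + j ≤ N + 1 →
      bracket2 F N (v F N j) (v F N i) =
        v F N i • lamS 1 (geom (i - 1) (const (v F N j) - lamS (-j) (const (v F N j)))) -
        ((∑ p ∈ Finset.Icc 2 j,
            v F N (i + j - p) • lamS ((i : ℤ) - p) (const (v F N p))) -
          ∑ p ∈ Finset.Icc i (i + j - 2),
            v F N (i + j - p) • lamS ((i : ℤ) - p) (const (v F N p))) +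
        (lamS (1 - j) (const (v F N (i + j - 1))) -
          lam ((i : ℤ) - 1) (const (v F N (i + j - 1))))) ∧
    (∀ i ∈ Finset.Icc 2 (N - 1), ∀ j ∈ Finset.Icc 2 (N - 1), N + 2 ≤ i + j →
      bracket2 F N (v F N j) (v F N i) =
        v F N i • lamS 1 (geom (i - 1) (const (v F N j) - lamS (-j) (const (v F N j)))) -
        ((∑ p ∈ Finset.Icc (i + j - N) j,
            v F N (i + j - p) • lamS ((i : ℤ) - p) (const (v F N p))) -
          ∑ p ∈ Finset.Icc i N,
            v F N (i + j - p) • lamS ((i : ℤ) - p) (const (v F N p)))) ∧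
    (∀ j ∈ Finset.Icc 2 (N - 1),
      bracket2 F N (v F N 1) (v F N j) = skew (bracket2 F N (v F N j) (v F N 1))) := by
  have h2 : ∀ {j : ℕ}, j ∈ Finset.Icc 2 (N - 1) → j ∈ Finset.Icc 2 N := fun hj =>
    Finset.Icc_subset_Icc_right (Nat.sub_le N 1) hj
  have hNN : N ∈ Finset.Icc 2 N := Finset.mem_Icc.mpr ⟨by omega, le_rfl⟩
  refine ⟨isLocalOn_of_generators _ fun i hi j hj => isLocalSeries_bracket1_v hi hj,
    isLocalOn_of_generators _ fun i hi j hj => isLocalSeries_bracket2_v hi hj, ?_,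
    fun j hj => ?_, fun i hi j hj => bracket1_v (h2 hi) (h2 hj), fun j _ => bracket1_skew _ _, ?_,
    fun j hj => ?_, fun i hi j hj _ => bracket2_v' (h2 hi) (h2 hj),
    fun i hi j hj => bracket2_v_of_le (h2 hi) (h2 hj), fun j hj => ?_⟩
  · rw [v_one]
    exact bracket1_v_last_last (by omega)
  · rw [v_one]
    exact bracket1_v_last (h2 hj)
  · rw [v_one]
    exact bracket2_v_last hNN
  · rw [v_one]
    exact bracket2_v_last (h2 hj)
  · rw [v_one]
    exact bracket2_v_skew (h2 hj)
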